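/- A skew brace is a set $B$ with two group operations $\oplus$ and $\odot$ (neither need be abelian) such that $a\odot(b\oplus c)=(a\odot b)\ominus a\oplus(a\odot c)$ for all $a,b,c\in B$, where $\ominus a$ is the inverse of $a$ for $\oplus$; its additive group is $(B,\oplus)$ and its multiplicative group is $(B,\odot)$. Two skew braces are isomorphic if there is a bijection between them that is a homomorphism for both operations. Let $p>3$ be a prime, let $C_p$ be the cyclic group of order $p$, and let $$M_1=\langle \rho,\sigma,\tau \mid \rho^p=\sigma^p=\tau^p=1,\ \sigma\rho=\rho\sigma,\ \tau\rho=\rho\tau,\ \tau\sigma=\rho\sigma\tau\rangle$$ be the Heisenberg group, the nonabelian group of order $p^3$ and exponent $p$. **Theorem.** Up to isomorphism, there are exactly $2p^2-p+3$ skew braces with additive group isomorphic to $M_1$ and multiplicative group isomorphic to $M_1$, and exactly $2p+1$ skew braces with additive group isomorphic to $M_1$ and multiplicative group isomorphic to $C_p^3$. Moreover, every skew brace with additive group isomorphic to $M_1$ has multiplicative group isomorphic to $M_1$ or to $C_p^3$. -/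

import Mathlib

universe u v w

/-- A skew (left) brace: a set with two group structures, the additive group `(B, +)` (not
necessarily abelian) and the multiplicative group `(B, *)`, related by
`a * (b + c) = a * b - a + a * c`. -/
class SkewBrace (B : Type u) extends AddGroup B, Group B where
  mul_add_eq : ∀ a b c : B, a * (b + c) = a * b - a + a * c

/-- A `G`-skew brace of type `N`: a skew brace whose additive group is isomorphic to `N` and whose
multiplicative group is isomorphic to `G`. (`Additive N` is the group `N` written additively.) -/
structure SkewBraceOfType (N : Type v) (G : Type w) [Group N] [Group G] where
  carrier : Type u
  [str : SkewBrace carrier]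
  type_iso : Nonempty (carrier ≃+ Additive N)
  structure_iso : Nonempty (carrier ≃* G)

attribute [instance] SkewBraceOfType.str

/-- Isomorphism of skew braces: a bijection that is a homomorphism for both group structures.
(`≃+*` asks for compatibility with `+` and `*` and for nothing else.) -/
instance SkewBraceOfType.isoSetoid (N : Type v) (G : Type w) [Group N] [Group G] :
    Setoid (SkewBraceOfType.{u} N G) where
  r A B := Nonempty (A.carrier ≃+* B.carrier)
  iseqv :=
    { refl := fun A => ⟨RingEquiv.refl A.carrier⟩
      symm := fun ⟨f⟩ => ⟨f.symm⟩
      trans := fun ⟨f⟩ ⟨g⟩ => ⟨f.trans g⟩ }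

/-- The isomorphism classes of `G`-skew braces of type `N` (with underlying set in `Type u`). -/
def SkewBraceClasses (N : Type v) (G : Type w) [Group N] [Group G] : Type (u + 1) :=
  Quotient (SkewBraceOfType.isoSetoid.{u} N G)

/-- The names of the generators of the Heisenberg group. -/
inductive HeisenbergGen where
  | rho
  | sigma
  | tau

open HeisenbergGen in
/-- The relations `ρ ^ p = σ ^ p = τ ^ p = 1`, `σρ = ρσ`, `τρ = ρτ`, `τσ = ρστ`, each written as
a word that is to become trivial. -/
def heisenbergRels (p : ℕ) : Set (FreeGroup HeisenbergGen) :=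
  {FreeGroup.of rho ^ p,
   FreeGroup.of sigma ^ p,
   FreeGroup.of tau ^ p,
   (FreeGroup.of sigma * FreeGroup.of rho) * (FreeGroup.of rho * FreeGroup.of sigma)⁻¹,
   (FreeGroup.of tau * FreeGroup.of rho) * (FreeGroup.of rho * FreeGroup.of tau)⁻¹,
   (FreeGroup.of tau * FreeGroup.of sigma) *
     (FreeGroup.of rho * FreeGroup.of sigma * FreeGroup.of tau)⁻¹}

/-- The Heisenberg group `⟨ρ, σ, τ ∣ ρ ^ p = σ ^ p = τ ^ p = 1, σρ = ρσ, τρ = ρτ, τσ = ρστ⟩`. -/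
abbrev HeisenbergGroup (p : ℕ) : Type := PresentedGroup (heisenbergRels p)

/-- The elementary abelian group `C_p × C_p × C_p`. -/
abbrev ElementaryAbelianCube (p : ℕ) : Type := Fin 3 → Multiplicative (ZMod p)

/-! A skew brace is governed by its left translations `λ_a b = -a + a * b`, which form an action of
the multiplicative group by automorphisms of the additive group. Since 2 is invertible, the
Heisenberg group has symmetric coordinates in which an automorphism is an invertible matrix `M`
together with a linear form, the centre being scaled by `det M`. The multiplicative group has order
`p ^ 3`, so its image in `GL₂` is a `p`-group and fixes a nonzero vector. Hence, up to isomorphism,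
every matrix is unitriangular and the brace is given by three functions `α`, `f`, `g`
(`SkewBrace.exists_braceData`).

The functional equations for these functions have three kinds of solution (`eq_of_α_center_eq_zero`,
`eq_of_α_center_ne_zero`). If `α = 0`, then `f`, `g` form a bilinear form: a symmetric part `S` and
an alternating part measured by `c`. If `α ≠ 0` vanishes on the centre, one gets `quadratic u w`. If
`α` is nonzero on the centre, one gets `central a μ`. Isomorphisms are changes of coordinates
(`Intertwines`). They keep `c`, `u`, `w`, they keep the square class of `a` and whether `μ = 0`, and
they act on `S` by `Mᵀ S M / det M`, whose orbits are zero and `diag (1, d)`.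

Explicit polynomial coordinates identify the multiplicative groups: elementary abelian when `c = 0`
or `u = w`, Heisenberg otherwise. The counts are `(p + 1)(p - 1) + p(p - 1) + 4` and `(p + 1) + p`.
-/

/-! ### Coordinates and automorphisms of the Heisenberg group. -/

/-- The Heisenberg group over `ZMod p` in symmetric coordinates, written additively. -/
@[ext]
structure Heis (p : ℕ) where
  x : ZMod p
  y : ZMod p
  z : ZMod p

namespace Heis

variable {p : ℕ}

instance : Zero (Heis p) := ⟨⟨0, 0, 0⟩⟩
instance : Add (Heis p) :=
  ⟨fun a b => ⟨a.x + b.x, a.y + b.y, a.z + b.z + (a.x * b.y - a.y * b.x)⟩⟩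
instance : Neg (Heis p) := ⟨fun a => ⟨-a.x, -a.y, -a.z⟩⟩

theorem zero_def : (0 : Heis p) = ⟨0, 0, 0⟩ := rfl
theorem add_def (a b : Heis p) :
    a + b = ⟨a.x + b.x, a.y + b.y, a.z + b.z + (a.x * b.y - a.y * b.x)⟩ := rfl
theorem neg_def (a : Heis p) : -a = ⟨-a.x, -a.y, -a.z⟩ := rfl

instance : AddGroup (Heis p) :=
  AddGroup.ofLeftAxioms
    (fun a b c => by simp only [add_def, mk.injEq]; refine ⟨?_, ?_, ?_⟩ <;> ring)
    (fun a => by simp [add_def, zero_def])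
    (fun a => by
      simp only [add_def, neg_def, zero_def, mk.injEq]; refine ⟨?_, ?_, ?_⟩ <;> ring)

@[simp] theorem zero_x : (0 : Heis p).x = 0 := rfl
@[simp] theorem zero_y : (0 : Heis p).y = 0 := rfl
@[simp] theorem zero_z : (0 : Heis p).z = 0 := rfl
@[simp] theorem add_x (a b : Heis p) : (a + b).x = a.x + b.x := rfl
@[simp] theorem add_y (a b : Heis p) : (a + b).y = a.y + b.y := rfl
@[simp] theorem add_z (a b : Heis p) :
    (a + b).z = a.z + b.z + (a.x * b.y - a.y * b.x) := rfl
@[simp] theorem neg_x (a : Heis p) : (-a).x = -a.x := rfl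
@[simp] theorem neg_y (a : Heis p) : (-a).y = -a.y := rfl
@[simp] theorem neg_z (a : Heis p) : (-a).z = -a.z := rfl

theorem nsmul_eq (n : ℕ) (a : Heis p) : n • a = ⟨n * a.x, n * a.y, n * a.z⟩ := by
  induction n with
  | zero => simp [zero_def]
  | succ n ih =>
    rw [succ_nsmul, ih]
    ext <;> simp <;> ring

/-- The underlying set of the Heisenberg group. -/
def equivProd (p : ℕ) : Heis p ≃ ZMod p × ZMod p × ZMod p where
  toFun a := (a.x, a.y, a.z)
  invFun t := ⟨t.1, t.2.1, t.2.2⟩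

theorem nat_card (p : ℕ) : Nat.card (Heis p) = p ^ 3 := by
  rw [Nat.card_congr (equivProd p)]
  simp [Nat.card_prod]
  ring

instance [NeZero p] : Finite (Heis p) := Finite.of_equiv _ (equivProd p).symm

/-- The endomorphism of the Heisenberg group given by a matrix and a linear form. -/
def linearHom (m₁₁ m₁₂ m₂₁ m₂₂ h₁ h₂ : ZMod p) : Heis p →+ Heis p where
  toFun a := ⟨m₁₁ * a.x + m₁₂ * a.y, m₂₁ * a.x + m₂₂ * a.y,
    (m₁₁ * m₂₂ - m₁₂ * m₂₁) * a.z + h₁ * a.x + h₂ * a.y⟩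
  map_zero' := by ext <;> simp
  map_add' a b := by
    ext <;> simp <;> ring

end Heis

theorem ZMod.two_ne_zero_of_three_lt {p : ℕ} (hp : 3 < p) : (2 : ZMod p) ≠ 0 := by
  intro h
  have := (ZMod.natCast_eq_zero_iff 2 p).1 (by exact_mod_cast h)
  exact absurd (Nat.le_of_dvd (by norm_num) this) (by omega)

theorem ZMod.three_ne_zero_of_three_lt {p : ℕ} (hp : 3 < p) : (3 : ZMod p) ≠ 0 := by
  intro h
  have := (ZMod.natCast_eq_zero_iff 3 p).1 (by exact_mod_cast h)
  exact absurd (Nat.le_of_dvd (by norm_num) this) (by omega)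

namespace Heis

variable {p : ℕ} [Fact p.Prime]

/-- Endomorphisms of the Heisenberg group are determined by a matrix and a linear form. -/
theorem addMonoidHom_form (h2 : (2 : ZMod p) ≠ 0) (f : Heis p →+ Heis p) (a : Heis p) :
    f a = ⟨(f ⟨1, 0, 0⟩).x * a.x + (f ⟨0, 1, 0⟩).x * a.y,
      (f ⟨1, 0, 0⟩).y * a.x + (f ⟨0, 1, 0⟩).y * a.y,
      ((f ⟨1, 0, 0⟩).x * (f ⟨0, 1, 0⟩).y - (f ⟨0, 1, 0⟩).x * (f ⟨1, 0, 0⟩).y) * a.z +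
        (f ⟨1, 0, 0⟩).z * a.x + (f ⟨0, 1, 0⟩).z * a.y⟩ := by
  -- The commutator of the two generators is `⟨0, 0, 2⟩` and the first two terms already contribute
  -- `x * y` to the last coordinate, whence the coefficient `(z - x * y) / 2`.
  have key : a = a.x.val • (⟨1, 0, 0⟩ : Heis p) + a.y.val • (⟨0, 1, 0⟩ : Heis p) +
      ((a.z - a.x * a.y) / 2).val • ((⟨1, 0, 0⟩ : Heis p) + ⟨0, 1, 0⟩ +
        -⟨1, 0, 0⟩ + -⟨0, 1, 0⟩) := by
    ext <;> simp [nsmul_eq]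
    field_simp
    ring
  conv_lhs => rw [key]
  simp only [map_add, map_nsmul, map_neg]
  generalize f ⟨1, 0, 0⟩ = s
  generalize f ⟨0, 1, 0⟩ = t
  ext <;> simp [nsmul_eq]
  · ring
  · ring
  · field_simp
    ring

theorem linearHom_injective {m₁₁ m₁₂ m₂₁ m₂₂ : ZMod p} (h₁ h₂ : ZMod p)
    (hd : m₁₁ * m₂₂ - m₁₂ * m₂₁ ≠ 0) :
    Function.Injective (linearHom m₁₁ m₁₂ m₂₁ m₂₂ h₁ h₂) := by
  rw [injective_iff_map_eq_zero]
  rintro ⟨x, y, z⟩ h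
  simp only [linearHom, AddMonoidHom.coe_mk, ZeroHom.coe_mk, zero_def, mk.injEq] at h ⊢
  obtain ⟨hx, hy, hz⟩ := h
  have hx0 : x = 0 := by
    refine (mul_eq_zero.1 (?_ : (m₁₁ * m₂₂ - m₁₂ * m₂₁) * x = 0)).resolve_left hd
    linear_combination m₂₂ * hx - m₁₂ * hy
  have hy0 : y = 0 := by
    refine (mul_eq_zero.1 (?_ : (m₁₁ * m₂₂ - m₁₂ * m₂₁) * y = 0)).resolve_left hd
    linear_combination m₁₁ * hy - m₂₁ * hx
  subst hx0 hy0
  refine ⟨rfl, rfl, (mul_eq_zero.1 (?_ : (m₁₁ * m₂₂ - m₁₂ * m₂₁) * z = 0)).resolve_left hd⟩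
  linear_combination hz

/-- The automorphism of the Heisenberg group given by an invertible matrix and a linear form. -/
noncomputable def linearEquiv (m₁₁ m₁₂ m₂₁ m₂₂ h₁ h₂ : ZMod p)
    (hd : m₁₁ * m₂₂ - m₁₂ * m₂₁ ≠ 0) : Heis p ≃+ Heis p :=
  AddEquiv.ofBijective (linearHom m₁₁ m₁₂ m₂₁ m₂₂ h₁ h₂)
    (Finite.injective_iff_bijective.1 (linearHom_injective h₁ h₂ hd))

theorem linearEquiv_apply {m₁₁ m₁₂ m₂₁ m₂₂ : ZMod p} (h₁ h₂ : ZMod p)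
    (hd : m₁₁ * m₂₂ - m₁₂ * m₂₁ ≠ 0) (a : Heis p) :
    linearEquiv m₁₁ m₁₂ m₂₁ m₂₂ h₁ h₂ hd a = ⟨m₁₁ * a.x + m₁₂ * a.y, m₂₁ * a.x + m₂₂ * a.y,
      (m₁₁ * m₂₂ - m₁₂ * m₂₁) * a.z + h₁ * a.x + h₂ * a.y⟩ := rfl

end Heis

/-! ### The presented group agrees with the coordinate model. -/

section Presentation

variable {p : ℕ}

theorem pow_val_add [NeZero p] {G : Type*} [Group G] {g : G} (hg : g ^ p = 1) (a b : ZMod p) :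
    g ^ (a + b).val = g ^ a.val * g ^ b.val := by
  rw [ZMod.val_add, ← pow_add]
  exact (pow_eq_pow_mod _ hg).symm

theorem pow_val_mul {G : Type*} [Group G] {g : G} (hg : g ^ p = 1) (a b : ZMod p) :
    g ^ (a * b).val = g ^ (a.val * b.val) := by
  rw [ZMod.val_mul]
  exact (pow_eq_pow_mod _ hg).symm

theorem pow_mul_pow_of_mul_eq {G : Type*} [Group G] {r s t : G} (hrs : Commute s r)
    (hrt : Commute t r) (h : t * s = r * s * t) (m n : ℕ) :
    t ^ n * s ^ m = r ^ (n * m) * s ^ m * t ^ n := by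
  have h1 : ∀ n : ℕ, t ^ n * s = r ^ n * s * t ^ n := by
    intro n
    induction n with
    | zero => simp
    | succ n ih =>
      calc t ^ (n + 1) * s = t * (t ^ n * s) := by rw [pow_succ', mul_assoc]
        _ = (t * r ^ n) * s * t ^ n := by rw [ih]; group
        _ = r ^ n * (t * s) * t ^ n := by rw [(hrt.pow_right n).eq]; group
        _ = r ^ (n + 1) * s * t ^ (n + 1) := by rw [h]; group
  induction m with
  | zero => simp
  | succ m ih =>
    calc t ^ n * s ^ (m + 1) = (t ^ n * s ^ m) * s := by rw [pow_succ, mul_assoc]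
      _ = r ^ (n * m) * s ^ m * (t ^ n * s) := by rw [ih]; group
      _ = r ^ (n * m) * (s ^ m * r ^ n) * s * t ^ n := by rw [h1]; group
      _ = r ^ (n * (m + 1)) * s ^ (m + 1) * t ^ n := by
        rw [(hrs.pow_pow m n).eq, mul_add, mul_one, pow_add, pow_succ]; group

/-- The images of the generators of the Heisenberg group in the coordinate model. -/
def heisGen (p : ℕ) : HeisenbergGen → Multiplicative (Heis p)
  -- The images of `τσ` and `στ` have last coordinates `-1` and `1`, so `τσ = ρστ` forces `-2`.
  | .rho => .ofAdd ⟨0, 0, -2⟩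
  | .sigma => .ofAdd ⟨1, 0, 0⟩
  | .tau => .ofAdd ⟨0, 1, 0⟩

theorem ofAdd_pow_eq (n : ℕ) (a : Heis p) :
    (Multiplicative.ofAdd a) ^ n = .ofAdd ⟨n * a.x, n * a.y, n * a.z⟩ := by
  rw [← ofAdd_nsmul, Heis.nsmul_eq]

theorem heisGen_rels : ∀ r ∈ heisenbergRels p, FreeGroup.lift (heisGen p) r = 1 := by
  intro r hr
  simp only [heisenbergRels, Set.mem_insert_iff, Set.mem_singleton_iff] at hr
  rcases hr with rfl | rfl | rfl | rfl | rfl | rfl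
  all_goals
    simp only [map_mul, map_pow, map_inv, FreeGroup.lift_apply_of, heisGen, ofAdd_pow_eq,
      ← ofAdd_add, ← ofAdd_zero]
    congr 1
    ext <;> simp <;> try ring

theorem heisenbergGroup_pow (g : HeisenbergGen) :
    (PresentedGroup.of g : HeisenbergGroup p) ^ p = 1 := by
  have : FreeGroup.of g ^ p ∈ heisenbergRels p := by
    cases g <;> simp [heisenbergRels]
  exact PresentedGroup.one_of_mem this

theorem heisenbergGroup_commute_sigma :
    Commute (PresentedGroup.of .sigma : HeisenbergGroup p) (PresentedGroup.of .rho) := by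
  have : (FreeGroup.of .sigma * FreeGroup.of .rho) * (FreeGroup.of .rho * FreeGroup.of .sigma)⁻¹
    ∈ heisenbergRels p := by simp [heisenbergRels]
  exact mul_inv_eq_one.1 (PresentedGroup.one_of_mem this)

theorem heisenbergGroup_commute_tau :
    Commute (PresentedGroup.of .tau : HeisenbergGroup p) (PresentedGroup.of .rho) := by
  have : (FreeGroup.of .tau * FreeGroup.of .rho) * (FreeGroup.of .rho * FreeGroup.of .tau)⁻¹
    ∈ heisenbergRels p := by simp [heisenbergRels]
  exact mul_inv_eq_one.1 (PresentedGroup.one_of_mem this)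

theorem heisenbergGroup_tau_mul_sigma :
    (PresentedGroup.of .tau * PresentedGroup.of .sigma : HeisenbergGroup p) =
      PresentedGroup.of .rho * PresentedGroup.of .sigma * PresentedGroup.of .tau := by
  have : (FreeGroup.of .tau * FreeGroup.of .sigma) *
    (FreeGroup.of .rho * FreeGroup.of .sigma * FreeGroup.of .tau)⁻¹
    ∈ heisenbergRels p := by simp [heisenbergRels]
  exact mul_inv_eq_one.1 (PresentedGroup.one_of_mem this)

variable [Fact p.Prime]

/-- The homomorphism from the coordinate model to the presented Heisenberg group. -/
def heisToPresented (h2 : (2 : ZMod p) ≠ 0) : Multiplicative (Heis p) →* HeisenbergGroup p :=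
  MonoidHom.mk' (fun a =>
    -- In the model `ρ ^ c σ ^ x τ ^ y` is `⟨x, y, x * y - 2 * c⟩`; the exponent solves for `c`.
    PresentedGroup.of HeisenbergGen.rho ^ ((a.toAdd.x * a.toAdd.y - a.toAdd.z) / 2).val *
      PresentedGroup.of HeisenbergGen.sigma ^ a.toAdd.x.val * PresentedGroup.of HeisenbergGen.tau ^ a.toAdd.y.val) <| by
    intro a b
    obtain ⟨x, y, z⟩ := a
    obtain ⟨x', y', z'⟩ := b
    have hc : ((x + x') * (y + y') - (z + z' + (x * y' - y * x'))) / 2 =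
        (x * y - z) / 2 + y * x' + (x' * y' - z') / 2 := by
      field_simp; ring
    change PresentedGroup.of HeisenbergGen.rho ^
      (((x + x') * (y + y') - (z + z' + (x * y' - y * x'))) / 2).val *
      PresentedGroup.of HeisenbergGen.sigma ^ (x + x').val * PresentedGroup.of HeisenbergGen.tau ^ (y + y').val =
      (PresentedGroup.of HeisenbergGen.rho ^ ((x * y - z) / 2).val *
      PresentedGroup.of HeisenbergGen.sigma ^ x.val * PresentedGroup.of HeisenbergGen.tau ^ y.val) *
      (PresentedGroup.of HeisenbergGen.rho ^ ((x' * y' - z') / 2).val *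
      PresentedGroup.of HeisenbergGen.sigma ^ x'.val * PresentedGroup.of HeisenbergGen.tau ^ y'.val)
    rw [hc]
    simp only [pow_val_add (heisenbergGroup_pow _), pow_val_mul (heisenbergGroup_pow _)]
    generalize (x * y - z) / 2 = c
    generalize (x' * y' - z') / 2 = c'
    have hsr := heisenbergGroup_commute_sigma (p := p)
    have htr := heisenbergGroup_commute_tau (p := p)
    have hts := pow_mul_pow_of_mul_eq hsr htr heisenbergGroup_tau_mul_sigma x'.val y.val
    generalize (PresentedGroup.of HeisenbergGen.rho : HeisenbergGroup p) = r at *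
    generalize (PresentedGroup.of HeisenbergGen.sigma : HeisenbergGroup p) = s at *
    generalize (PresentedGroup.of HeisenbergGen.tau : HeisenbergGroup p) = t at *
    calc r ^ c.val * r ^ (y.val * x'.val) * r ^ c'.val * (s ^ x.val * s ^ x'.val) *
          (t ^ y.val * t ^ y'.val)
        = r ^ c.val * (r ^ c'.val * r ^ (y.val * x'.val) * s ^ x.val) * s ^ x'.val * t ^ y.val *
          t ^ y'.val := by
          rw [← (Commute.refl r).pow_pow (y.val * x'.val) c'.val]; group
      _ = r ^ c.val * s ^ x.val * r ^ c'.val * (r ^ (y.val * x'.val) * s ^ x'.val * t ^ y.val) *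
          t ^ y'.val := by
          rw [← pow_add, ← (hsr.pow_pow x.val (c'.val + y.val * x'.val)).eq, pow_add]; group
      _ = r ^ c.val * s ^ x.val * (r ^ c'.val * t ^ y.val) * s ^ x'.val * t ^ y'.val := by
          rw [← hts]; group
      _ = r ^ c.val * s ^ x.val * t ^ y.val * (r ^ c'.val * s ^ x'.val * t ^ y'.val) := by
          rw [← (htr.pow_pow y.val c'.val).eq]; group

/-- The presented Heisenberg group is isomorphic to the coordinate model. -/
theorem nonempty_heisenbergGroup_mulEquiv (hp3 : 3 < p) :
    Nonempty (HeisenbergGroup p ≃* Multiplicative (Heis p)) := by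
  have h2 := ZMod.two_ne_zero_of_three_lt hp3
  have : Fact (1 < p) := ⟨by omega⟩
  refine ⟨MulEquiv.ofBijective (PresentedGroup.toGroup heisGen_rels) ⟨?_, ?_⟩⟩
  · refine Function.LeftInverse.injective (g := heisToPresented h2) fun a => ?_
    have : (heisToPresented h2).comp (PresentedGroup.toGroup heisGen_rels) =
        MonoidHom.id (HeisenbergGroup p) := by
      refine PresentedGroup.ext fun g => ?_
      rw [MonoidHom.comp_apply, PresentedGroup.toGroup.of]
      cases g <;> simp [heisGen, heisToPresented, ZMod.val_one, h2]
    exact DFunLike.congr_fun this a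
  · refine Function.RightInverse.surjective (g := heisToPresented h2) fun a => ?_
    obtain ⟨x, y, z⟩ := a
    change PresentedGroup.toGroup heisGen_rels (PresentedGroup.of HeisenbergGen.rho ^ ((x * y - z) / 2).val *
      PresentedGroup.of HeisenbergGen.sigma ^ x.val * PresentedGroup.of HeisenbergGen.tau ^ y.val) =
      Multiplicative.ofAdd ⟨x, y, z⟩
    simp only [map_mul, map_pow, PresentedGroup.toGroup.of, heisGen, ofAdd_pow_eq]
    rw [← ofAdd_add, ← ofAdd_add]
    refine congrArg Multiplicative.ofAdd ?_
    ext <;> simp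
    field_simp
    ring

end Presentation

/-! ### Unitriangular data and their skew braces. -/

/-- The product `a + λ_a b` on the Heisenberg group, where `λ_a` is the automorphism given by the
unitriangular matrix with upper right entry `α a` and the linear form `(f a, g a)`. -/
def Heis.twistMul {p : ℕ} (α f g : Heis p → ZMod p) (a b : Heis p) : Heis p :=
  ⟨a.x + b.x + α a * b.y, a.y + b.y,
    a.z + b.z + f a * b.x + g a * b.y + (a.x * b.y - a.y * (b.x + α a * b.y))⟩

/-- A skew brace structure on the Heisenberg group all of whose left translations act
unitriangularly. -/
@[ext]
structure BraceData (p : ℕ) where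
  α : Heis p → ZMod p
  f : Heis p → ZMod p
  g : Heis p → ZMod p
  map_α : ∀ a b, α (Heis.twistMul α f g a b) = α a + α b
  map_f : ∀ a b, f (Heis.twistMul α f g a b) = f a + f b
  -- The extra term arises in `λ_a λ_b`, where the form of `a` is evaluated after the matrix of `b`.
  map_g : ∀ a b, g (Heis.twistMul α f g a b) = g a + g b + α b * f a

namespace BraceData

variable {p : ℕ} (D : BraceData p)

/-- The product of the skew brace. -/
def mul : Heis p → Heis p → Heis p := Heis.twistMul D.α D.f D.g

theorem mul_def (a b : Heis p) : D.mul a b =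
    ⟨a.x + b.x + D.α a * b.y, a.y + b.y,
      a.z + b.z + D.f a * b.x + D.g a * b.y + (a.x * b.y - a.y * (b.x + D.α a * b.y))⟩ := rfl

theorem α_mul (a b : Heis p) : D.α (D.mul a b) = D.α a + D.α b := D.map_α a b
theorem f_mul (a b : Heis p) : D.f (D.mul a b) = D.f a + D.f b := D.map_f a b
theorem g_mul (a b : Heis p) : D.g (D.mul a b) = D.g a + D.g b + D.α b * D.f a := D.map_g a b

theorem mul_zero_zero : D.mul 0 0 = 0 := by
  ext <;> simp [mul_def]

theorem α_zero : D.α 0 = 0 := by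
  have := D.α_mul 0 0
  rwa [mul_zero_zero, left_eq_add] at this

/-- The type on which the skew brace given by `D` lives. -/
def Carrier (_ : BraceData p) : Type := Heis p

/-- The multiplicative inverse `-λ_a⁻¹ a`. -/
def inv (a : Heis p) : Heis p :=
  ⟨-a.x + D.α a * a.y, -a.y, -a.z - D.f a * (-a.x + D.α a * a.y) + D.g a * a.y⟩

instance : AddGroup D.Carrier := inferInstanceAs (AddGroup (Heis p))

instance : Group D.Carrier :=
  letI : Mul D.Carrier := ⟨D.mul⟩
  letI : One D.Carrier := ⟨(0 : Heis p)⟩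
  letI : Inv D.Carrier := ⟨D.inv⟩
  Group.ofRightAxioms
    (fun (a b c : Heis p) => by
      change D.mul (D.mul a b) c = D.mul a (D.mul b c)
      have h1 := D.α_mul a b
      have h2 := D.f_mul a b
      have h3 := D.g_mul a b
      rw [D.mul_def (D.mul a b) c, h1, h2, h3]
      ext <;> simp only [D.mul_def] <;> ring)
    (fun (a : Heis p) => by
      change D.mul a 0 = a
      ext <;> simp [D.mul_def])
    (fun (a : Heis p) => by
      change D.mul a (D.inv a) = 0
      ext <;> simp only [D.mul_def, inv, Heis.zero_def] <;> ring)

instance : SkewBrace D.Carrier where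
  mul_add_eq := fun (a b c : Heis p) => by
    change D.mul a (b + c) = D.mul a b - a + D.mul a c
    rw [sub_eq_add_neg]
    ext <;> simp [D.mul_def] <;> ring

variable {D}

theorem nonempty_equiv_of_addEquiv {B : Type*} [SkewBrace B] (e : B ≃+ Heis p)
    (h : ∀ a b, e (a * b) = D.mul (e a) (e b)) : Nonempty (B ≃+* D.Carrier) :=
  ⟨{ e with
      map_mul' := h
      map_add' := fun a b => e.map_add a b }⟩

end BraceData

/-! ### Reduction of an arbitrary skew brace to unitriangular data. -/

namespace SkewBrace

variable {B : Type u} [SkewBrace B]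

theorem one_eq_zero : (1 : B) = 0 := by
  have := SkewBrace.mul_add_eq (1 : B) 0 0
  simpa using this

/-- The left translation action `λ_a b = -a + a * b` on the additive group. -/
def lam (a : B) : B →+ B :=
  AddMonoidHom.mk' (fun b => -a + a * b) fun b c => by
    rw [SkewBrace.mul_add_eq, sub_eq_add_neg]
    simp only [add_assoc]

theorem lam_apply (a b : B) : lam a b = -a + a * b := rfl

theorem mul_eq_add_lam (a b : B) : a * b = a + lam a b := by
  simp [lam_apply]

theorem lam_mul (a b c : B) : lam (a * b) c = lam a (lam b c) := by
  have h1 : (a * b) * c = a * b + lam (a * b) c := mul_eq_add_lam _ _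
  have h2 : a * (b * c) = a * b + lam a (lam b c) := by
    rw [mul_eq_add_lam a (b * c), mul_eq_add_lam b c, map_add, ← add_assoc,
      ← mul_eq_add_lam a b]
  rw [mul_assoc] at h1
  exact add_left_cancel (h1.symm.trans h2)

theorem lam_one (c : B) : lam 1 c = c := by
  rw [lam_apply, one_mul, one_eq_zero, neg_zero, zero_add]

variable {p : ℕ}

/-- The left translation action in the coordinates given by `e`. -/
def coordLam (e : B ≃+ Heis p) (a : B) : Heis p →+ Heis p :=
  (e.toAddMonoidHom.comp (lam a)).comp e.symm.toAddMonoidHom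

theorem coordLam_apply (e : B ≃+ Heis p) (a : B) (w : Heis p) :
    coordLam e a w = e (lam a (e.symm w)) := rfl

theorem coordLam_mul (e : B ≃+ Heis p) (a b : B) (w : Heis p) :
    coordLam e (a * b) w = coordLam e a (coordLam e b w) := by
  simp [coordLam_apply, lam_mul]

theorem coordLam_one (e : B ≃+ Heis p) (w : Heis p) : coordLam e 1 w = w := by
  simp [coordLam_apply, lam_one]

theorem apply_mul_eq (e : B ≃+ Heis p) (a b : B) : e (a * b) = e a + coordLam e a (e b) := by
  rw [mul_eq_add_lam, map_add, coordLam_apply, e.symm_apply_apply]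

theorem nat_card_eq (e : B ≃+ Heis p) : Nat.card B = p ^ 3 := by
  rw [Nat.card_congr e.toEquiv, Heis.nat_card]

variable [Fact p.Prime]

/-- The left translations fix a common vector of the Heisenberg group modulo its centre. -/
theorem exists_fixed_vector (h2 : (2 : ZMod p) ≠ 0) (e : B ≃+ Heis p) :
    ∃ s t : ZMod p, (s ≠ 0 ∨ t ≠ 0) ∧
      ∀ a z, (coordLam e a ⟨s, t, z⟩).x = s ∧ (coordLam e a ⟨s, t, z⟩).y = t := by
  have hz : ∀ (a : B) (w w' : Heis p), w.x = w'.x → w.y = w'.y →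
      (coordLam e a w).x = (coordLam e a w').x ∧ (coordLam e a w).y = (coordLam e a w').y := by
    intro a w w' hx hy
    rw [Heis.addMonoidHom_form h2 (coordLam e a) w, Heis.addMonoidHom_form h2 (coordLam e a) w',
      hx, hy]
    exact ⟨rfl, rfl⟩
  let _ : MulAction B (ZMod p × ZMod p) :=
    { smul := fun a v => ((coordLam e a ⟨v.1, v.2, 0⟩).x, (coordLam e a ⟨v.1, v.2, 0⟩).y)
      one_smul := fun v => by
        change ((coordLam e 1 ⟨v.1, v.2, 0⟩).x, (coordLam e 1 ⟨v.1, v.2, 0⟩).y) = v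
        rw [coordLam_one]
      mul_smul := fun a b v => by
        have := hz a (coordLam e b ⟨v.1, v.2, 0⟩)
          ⟨(coordLam e b ⟨v.1, v.2, 0⟩).x, (coordLam e b ⟨v.1, v.2, 0⟩).y, 0⟩ rfl rfl
        exact Prod.ext
          (by change (coordLam e (a * b) _).x = _; rw [coordLam_mul]; exact this.1)
          (by change (coordLam e (a * b) _).y = _; rw [coordLam_mul]; exact this.2) }
  have hsmul : ∀ (a : B) (v : ZMod p × ZMod p),
      a • v = ((coordLam e a ⟨v.1, v.2, 0⟩).x, (coordLam e a ⟨v.1, v.2, 0⟩).y) :=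
    fun _ _ => rfl
  have hG : IsPGroup p B := IsPGroup.of_card (nat_card_eq e)
  have h0 : (0 : ZMod p × ZMod p) ∈ MulAction.fixedPoints B (ZMod p × ZMod p) := by
    intro a
    have : coordLam e a ⟨0, 0, 0⟩ = 0 := map_zero (coordLam e a)
    rw [hsmul]
    simp [this]
  -- The number of fixed points of a `p`-group on a set of size `p ^ 2` is divisible by `p`, so zero
  -- is not the only one.
  obtain ⟨⟨s, t⟩, hfix, hne⟩ := hG.exists_fixed_point_of_prime_dvd_card_of_fixed_point
    (ZMod p × ZMod p) (by simp) h0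
  refine ⟨s, t, ?_, fun a z => ?_⟩
  · by_contra! h
    exact hne (Prod.ext h.1.symm h.2.symm)
  · have h1 := hfix a
    rw [hsmul, Prod.mk.injEq] at h1
    have h3 := hz a ⟨s, t, z⟩ ⟨s, t, 0⟩ rfl rfl
    exact ⟨h3.1.trans h1.1, h3.2.trans h1.2⟩

/-- In suitable coordinates the left translations fix the first basis vector modulo the centre. -/
theorem exists_addEquiv_fixing (h2 : (2 : ZMod p) ≠ 0) (e : B ≃+ Heis p) :
    ∃ e' : B ≃+ Heis p, ∀ a, (coordLam e' a ⟨1, 0, 0⟩).x = 1 ∧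
      (coordLam e' a ⟨1, 0, 0⟩).y = 0 := by
  obtain ⟨s, t, hst, hfix⟩ := exists_fixed_vector h2 e
  obtain ⟨q, r, hd⟩ : ∃ q r : ZMod p, s * r - q * t ≠ 0 := by
    rcases hst with h | h
    · exact ⟨0, 1, by simpa using h⟩
    · exact ⟨1, 0, by simpa using h⟩
  let ψ := Heis.linearEquiv s q t r 0 0 hd
  have hψ : ψ ⟨1, 0, 0⟩ = ⟨s, t, 0⟩ := by
    rw [Heis.linearEquiv_apply]; ext <;> simp
  refine ⟨e.trans ψ.symm, fun a => ?_⟩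
  have h1 : coordLam (e.trans ψ.symm) a ⟨1, 0, 0⟩ = ψ.symm (coordLam e a ⟨s, t, 0⟩) := by
    rw [← hψ]; rfl
  have h3 := hfix a 0
  have h4 : ψ (coordLam (e.trans ψ.symm) a ⟨1, 0, 0⟩) = coordLam e a ⟨s, t, 0⟩ := by
    rw [h1, ψ.apply_symm_apply]
  generalize coordLam (e.trans ψ.symm) a ⟨1, 0, 0⟩ = w at *
  rw [Heis.linearEquiv_apply] at h4
  have hx := congrArg Heis.x h4
  have hy := congrArg Heis.y h4
  simp only [h3.1, h3.2] at hx hy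
  constructor
  · refine mul_left_cancel₀ hd ?_
    linear_combination r * hx - q * hy
  · refine mul_left_cancel₀ hd ?_
    linear_combination s * hy - t * hx

/-- Every skew brace of Heisenberg type is isomorphic to one given by unitriangular data. -/
theorem exists_braceData (h2 : (2 : ZMod p) ≠ 0) (e₀ : B ≃+ Heis p) :
    ∃ D : BraceData p, Nonempty (B ≃+* D.Carrier) := by
  obtain ⟨e, he⟩ := exists_addEquiv_fixing h2 e₀
  have hform : ∀ a w, coordLam e a w = ⟨w.x + (coordLam e a ⟨0, 1, 0⟩).x * w.y,
      (coordLam e a ⟨0, 1, 0⟩).y * w.y, (coordLam e a ⟨0, 1, 0⟩).y * w.z +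
        (coordLam e a ⟨1, 0, 0⟩).z * w.x + (coordLam e a ⟨0, 1, 0⟩).z * w.y⟩ := by
    intro a w
    conv_lhs => rw [Heis.addMonoidHom_form h2 (coordLam e a) w, (he a).1, (he a).2]
    simp
  -- The second diagonal entry is multiplicative, so its `p ^ 3`-th power is 1; by Fermat that power
  -- is the entry itself.
  have hq : ∀ a : B, (coordLam e a ⟨0, 1, 0⟩).y = 1 := by
    let φ : B →* ZMod p :=
      { toFun := fun a => (coordLam e a ⟨0, 1, 0⟩).y
        map_one' := by rw [coordLam_one]
        map_mul' := fun a b => by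
          rw [coordLam_mul, hform a (coordLam e b ⟨0, 1, 0⟩)] }
    intro a
    have h1 : a ^ p ^ 3 = 1 := by rw [← nat_card_eq e]; exact pow_card_eq_one'
    have h3 : φ a ^ p ^ 3 = 1 := by rw [← map_pow, h1, map_one]
    rwa [ZMod.pow_card_pow] at h3
  simp only [hq, one_mul] at hform
  let α : Heis p → ZMod p := fun w => (coordLam e (e.symm w) ⟨0, 1, 0⟩).x
  let f : Heis p → ZMod p := fun w => (coordLam e (e.symm w) ⟨1, 0, 0⟩).z
  let g : Heis p → ZMod p := fun w => (coordLam e (e.symm w) ⟨0, 1, 0⟩).z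
  have hmul : ∀ a b : B, e (a * b) = Heis.twistMul α f g (e a) (e b) := by
    intro a b
    rw [apply_mul_eq, hform a (e b)]
    ext
    · simp [Heis.twistMul, α]; ring
    · simp [Heis.twistMul]
    · simp [Heis.twistMul, α, f, g]; ring
  have hsymm : ∀ a b, e.symm (Heis.twistMul α f g a b) = e.symm a * e.symm b := by
    intro a b
    rw [e.symm_apply_eq, hmul, e.apply_symm_apply, e.apply_symm_apply]
  refine ⟨⟨α, f, g, fun a b => ?_, fun a b => ?_, fun a b => ?_⟩,
    BraceData.nonempty_equiv_of_addEquiv e hmul⟩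
  · simp only [α, hsymm, coordLam_mul]
    rw [hform (e.symm a) (coordLam e (e.symm b) ⟨0, 1, 0⟩)]
    simp only [hq]; ring
  · simp only [f, hsymm, coordLam_mul]
    rw [hform (e.symm a) (coordLam e (e.symm b) ⟨1, 0, 0⟩), (he _).1, (he _).2]
    simp only; ring
  · simp only [g, f, α, hsymm, coordLam_mul]
    rw [hform (e.symm a) (coordLam e (e.symm b) ⟨0, 1, 0⟩)]
    simp only [hq]; ring

end SkewBrace

/-! ### Functional equations over the prime field. -/

section FunctionalEquations

variable {p : ℕ} [Fact p.Prime] {F : ZMod p → ZMod p}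

theorem ZMod.eq_mul_of_additive (h : ∀ s t, F (s + t) = F s + F t) (t : ZMod p) :
    F t = F 1 * t := by
  have h1 := map_nsmul (AddMonoidHom.mk' F h) t.val 1
  simpa [mul_comm] using h1

/-- Adding `k / 2 * t ^ 2` to `F` cancels the polar form and leaves an additive function. -/
theorem ZMod.eq_quadratic_of_polarization (h2 : (2 : ZMod p) ≠ 0) {k : ZMod p}
    (h : ∀ s t, F s + F t - F (s + t) = k * s * t) (t : ZMod p) :
    F t = (F 1 + k / 2) * t - k / 2 * t ^ 2 := by
  have h1 := ZMod.eq_mul_of_additive (F := fun t => F t + k / 2 * t ^ 2) (fun s t => by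
    linear_combination -h s t + k * s * t * mul_inv_cancel₀ h2) t
  linear_combination h1

end FunctionalEquations

/-! ### Solving the equations for `α`, `f`, `g`. -/

namespace BraceData

variable {p : ℕ}

section Solve

variable (D : BraceData p)

theorem α_center_add (s t : ZMod p) :
    D.α ⟨0, 0, s + t⟩ = D.α ⟨0, 0, s⟩ + D.α ⟨0, 0, t⟩ := by
  rw [← D.α_mul]; congr 1; ext <;> simp [mul_def]

theorem f_center_add (s t : ZMod p) :
    D.f ⟨0, 0, s + t⟩ = D.f ⟨0, 0, s⟩ + D.f ⟨0, 0, t⟩ := by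
  rw [← D.f_mul]; congr 1; ext <;> simp [mul_def]

/-- Left translations fix the additive centre pointwise, so a central right factor is simply added.
This separates the dependence of `α`, `f`, `g` on the last coordinate. -/
theorem mul_center (x y z : ZMod p) : D.mul ⟨x, y, 0⟩ ⟨0, 0, z⟩ = ⟨x, y, z⟩ := by
  ext <;> simp [mul_def]

theorem mul_first (x x' : ZMod p) :
    D.mul ⟨x, 0, 0⟩ ⟨x', 0, 0⟩ = ⟨x + x', 0, D.f ⟨x, 0, 0⟩ * x'⟩ := by
  ext <;> simp [mul_def]

theorem mul_first_second (x y : ZMod p) : D.mul ⟨x, 0, 0⟩ ⟨0, y, 0⟩ =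
    ⟨x + D.α ⟨x, 0, 0⟩ * y, y, (D.g ⟨x, 0, 0⟩ + x) * y⟩ := by
  ext <;> simp [mul_def]
  ring

theorem mul_second_first (x y : ZMod p) : D.mul ⟨0, y, 0⟩ ⟨x, 0, 0⟩ =
    ⟨x, y, (D.f ⟨0, y, 0⟩ - y) * x⟩ := by
  ext <;> simp [mul_def]
  ring

theorem mul_second (y y' : ZMod p) : D.mul ⟨0, y, 0⟩ ⟨0, y', 0⟩ =
    ⟨D.α ⟨0, y, 0⟩ * y', y + y', (D.g ⟨0, y, 0⟩ - y * D.α ⟨0, y, 0⟩) * y'⟩ := by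
  ext <;> simp [mul_def]
  ring

theorem center_mul (x y z t : ZMod p) : D.mul ⟨0, 0, t⟩ ⟨x, y, z⟩ =
    ⟨x + D.α ⟨0, 0, t⟩ * y, y, t + z + D.f ⟨0, 0, t⟩ * x + D.g ⟨0, 0, t⟩ * y⟩ := by
  ext <;> simp [mul_def]

variable [Fact p.Prime]

theorem α_eq_add (x y z : ZMod p) :
    D.α ⟨x, y, z⟩ = D.α ⟨x, y, 0⟩ + D.α ⟨0, 0, 1⟩ * z := by
  rw [← D.mul_center x y z, α_mul,
    ZMod.eq_mul_of_additive (F := fun z => D.α ⟨0, 0, z⟩) D.α_center_add z]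

/-- With `c = f ⟨0, 0, 1⟩`, the product of `⟨0, 0, 1⟩` and `⟨1, 0, 0⟩` has last coordinate `1 + c`;
additivity of `f` gives `c * (1 + c) = c`, so `c ^ 2 = 0`. -/
theorem f_center (z : ZMod p) : D.f ⟨0, 0, z⟩ = 0 := by
  have hz : ∀ z, D.f ⟨0, 0, z⟩ = D.f ⟨0, 0, 1⟩ * z :=
    ZMod.eq_mul_of_additive (F := fun z => D.f ⟨0, 0, z⟩) D.f_center_add
  have hxz : ∀ x y z, D.f ⟨x, y, z⟩ = D.f ⟨x, y, 0⟩ + D.f ⟨0, 0, 1⟩ * z := fun x y z => by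
    rw [← D.mul_center x y z, f_mul, hz]
  have h1 := D.f_mul ⟨0, 0, 1⟩ ⟨1, 0, 0⟩
  rw [center_mul] at h1
  simp only [mul_zero, add_zero, mul_one] at h1
  rw [hxz] at h1
  have h3 : D.f ⟨0, 0, 1⟩ = 0 := by
    refine pow_eq_zero_iff two_ne_zero |>.1 ?_
    linear_combination h1
  rw [hz, h3, zero_mul]

theorem f_eq (x y z : ZMod p) : D.f ⟨x, y, z⟩ = D.f ⟨x, y, 0⟩ := by
  rw [← D.mul_center x y z, f_mul, f_center, add_zero]

theorem f_first (x : ZMod p) : D.f ⟨x, 0, 0⟩ = D.f ⟨1, 0, 0⟩ * x :=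
  ZMod.eq_mul_of_additive (F := fun x => D.f ⟨x, 0, 0⟩) (fun x x' => by
    rw [← f_mul, mul_first, f_eq _ _ _ (_ * _)]) x

theorem g_center (z : ZMod p) : D.g ⟨0, 0, z⟩ = D.g ⟨0, 0, 1⟩ * z :=
  ZMod.eq_mul_of_additive (F := fun x => D.g ⟨0, 0, x⟩) (fun x x' => by
    have := D.g_mul ⟨0, 0, x⟩ ⟨0, 0, x'⟩
    rw [D.f_center, mul_zero, add_zero] at this
    rw [← this]
    congr 1
    ext <;> simp [mul_def]) z

theorem g_eq_add (x y z : ZMod p) : D.g ⟨x, y, z⟩ =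
    D.g ⟨x, y, 0⟩ + D.g ⟨0, 0, 1⟩ * z + D.α ⟨0, 0, 1⟩ * z * D.f ⟨x, y, 0⟩ := by
  rw [← D.mul_center x y z, g_mul, g_center,
    ZMod.eq_mul_of_additive (F := fun z => D.α ⟨0, 0, z⟩) D.α_center_add z]

/-- The data for which the centre of the additive group acts trivially. -/
theorem eq_of_α_center_eq_zero (h2 : (2 : ZMod p) ≠ 0) (h0 : D.α ⟨0, 0, 1⟩ = 0) :
    ∃ b c₁ c₂ d₁ d₂ : ZMod p, b * c₁ = 0 ∧ ∀ x y z, D.α ⟨x, y, z⟩ = b * y ∧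
      D.f ⟨x, y, z⟩ = c₁ * x + c₂ * y ∧
      D.g ⟨x, y, z⟩ = d₁ * x + d₂ * y + b * (c₂ - d₁) / 2 * y ^ 2 := by
  have hα : ∀ x y z, D.α ⟨x, y, z⟩ = D.α ⟨x, y, 0⟩ := fun x y z => by
    rw [α_eq_add, h0, zero_mul, add_zero]
  have hα1 : ∀ x, D.α ⟨x, 0, 0⟩ = D.α ⟨1, 0, 0⟩ * x :=
    ZMod.eq_mul_of_additive (F := fun x => D.α ⟨x, 0, 0⟩) (fun x x' => by
      rw [← α_mul, mul_first, hα _ _ (_ * _)])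
  have hb : D.α ⟨1, 0, 0⟩ = 0 := by
    by_contra hb
    -- This second factor makes the first coordinate of the product vanish. Up to the centre, the
    -- product then equals its second factor, so `α ⟨1, 0, 0⟩ = 0`.
    have h1 := D.α_mul ⟨1, 0, 0⟩ ⟨0, -(D.α ⟨1, 0, 0⟩)⁻¹, 0⟩
    rw [mul_first_second, hα] at h1
    have h3 : 1 + D.α ⟨1, 0, 0⟩ * -(D.α ⟨1, 0, 0⟩)⁻¹ = 0 := by
      rw [mul_neg, mul_inv_cancel₀ hb, add_neg_cancel]
    rw [h3] at h1
    exact hb (by linear_combination -h1)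
  have hα2 : ∀ x y, D.α ⟨x, y, 0⟩ = D.α ⟨0, y, 0⟩ := fun x y => by
    have h1 := D.α_mul ⟨0, y, 0⟩ ⟨x, 0, 0⟩
    rw [mul_second_first, hα, hα1, hb] at h1
    linear_combination h1
  have hα3 : ∀ y, D.α ⟨0, y, 0⟩ = D.α ⟨0, 1, 0⟩ * y :=
    ZMod.eq_mul_of_additive (F := fun y => D.α ⟨0, y, 0⟩) (fun y y' => by
      rw [← α_mul, mul_second, hα _ _ (_ * _), hα2 (_ * _)])
  have hf1 : ∀ x y, D.f ⟨x, y, 0⟩ = D.f ⟨0, y, 0⟩ + D.f ⟨1, 0, 0⟩ * x := fun x y => by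
    have h1 := D.f_mul ⟨0, y, 0⟩ ⟨x, 0, 0⟩
    rwa [mul_second_first, f_eq, f_first] at h1
  -- The square-zero argument of `f_center`, now along the second axis.
  have hg0 : D.g ⟨0, 0, 1⟩ = 0 := by
    have h1 := D.g_mul ⟨0, 0, 1⟩ ⟨0, 1, 0⟩
    rw [center_mul, h0, D.f_center, D.g_eq_add _ _ (_ + _), h0] at h1
    simp only [zero_mul, mul_zero, mul_one, add_zero] at h1
    refine pow_eq_zero_iff two_ne_zero |>.1 ?_
    linear_combination h1
  have hg : ∀ x y z, D.g ⟨x, y, z⟩ = D.g ⟨x, y, 0⟩ := fun x y z => by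
    rw [g_eq_add, h0, hg0]; ring
  have hg1 : ∀ x, D.g ⟨x, 0, 0⟩ = D.g ⟨1, 0, 0⟩ * x :=
    ZMod.eq_mul_of_additive (F := fun x => D.g ⟨x, 0, 0⟩) (fun x x' => by
      have h1 := D.g_mul ⟨x, 0, 0⟩ ⟨x', 0, 0⟩
      rw [mul_first, hg, hα1, hb] at h1
      linear_combination h1)
  have hg2 : ∀ x y, D.g ⟨x, y, 0⟩ = D.g ⟨0, y, 0⟩ + D.g ⟨1, 0, 0⟩ * x := fun x y => by
    have h1 := D.g_mul ⟨0, y, 0⟩ ⟨x, 0, 0⟩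
    rw [mul_second_first, hg, hα1, hb, hg1 x] at h1
    linear_combination h1
  -- The products of `⟨1, 0, 0⟩` and `⟨0, 1, 0⟩` in both orders differ only in the centre, which `g`
  -- ignores, but the twist term of `g_mul` survives in just one order.
  have hbc : D.α ⟨0, 1, 0⟩ * D.f ⟨1, 0, 0⟩ = 0 := by
    have h1 := D.g_mul ⟨1, 0, 0⟩ ⟨0, 1, 0⟩
    rw [mul_first_second, hg, hb, hg2] at h1
    linear_combination -h1
  have hf2 : ∀ y, D.f ⟨0, y, 0⟩ = D.f ⟨0, 1, 0⟩ * y :=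
    ZMod.eq_mul_of_additive (F := fun y => D.f ⟨0, y, 0⟩) (fun y y' => by
      have h1 := D.f_mul ⟨0, y, 0⟩ ⟨0, y', 0⟩
      rw [mul_second, f_eq, hf1, hα3] at h1
      linear_combination h1 - y * y' * hbc)
  have hg3 := ZMod.eq_quadratic_of_polarization (F := fun y => D.g ⟨0, y, 0⟩) h2
    (k := D.α ⟨0, 1, 0⟩ * (D.g ⟨1, 0, 0⟩ - D.f ⟨0, 1, 0⟩)) (fun y y' => by
      have h1 := D.g_mul ⟨0, y, 0⟩ ⟨0, y', 0⟩
      rw [mul_second, hg, hg2, hα3 y, hα3 y', hf2] at h1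
      linear_combination -h1)
  refine ⟨D.α ⟨0, 1, 0⟩, D.f ⟨1, 0, 0⟩, D.f ⟨0, 1, 0⟩, D.g ⟨1, 0, 0⟩, D.g ⟨0, 1, 0⟩ +
    D.α ⟨0, 1, 0⟩ * (D.g ⟨1, 0, 0⟩ - D.f ⟨0, 1, 0⟩) / 2, hbc, fun x y z => ⟨?_, ?_, ?_⟩⟩
  · rw [hα, hα2, hα3]
  · rw [f_eq, hf1, hf2]; ring
  · rw [hg, hg2, hg3 y]; ring

/-- The data for which the centre of the additive group acts nontrivially. -/
theorem eq_of_α_center_ne_zero (h2 : (2 : ZMod p) ≠ 0) {a : ZMod p}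
    (ha : D.α ⟨0, 0, 1⟩ = a) (h0 : a ≠ 0) :
    ∃ b n k : ZMod p, ∀ x y z, D.α ⟨x, y, z⟩ = a * z + b * x + n * y - k / 2 * y ^ 2 ∧
      D.f ⟨x, y, z⟩ = y ∧
      a * D.g ⟨x, y, z⟩ = -(a + b ^ 2) * x + a * b * x * y - a * b * z + a ^ 2 * y * z +
        k * y + (a * y - b) * (n * y - k / 2 * y ^ 2) := by
  have hα : ∀ x y z, D.α ⟨x, y, z⟩ = D.α ⟨x, y, 0⟩ + a * z := fun x y z => by
    rw [α_eq_add, ha]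
  have hα0 : D.α ⟨0, 0, 0⟩ = 0 := D.α_zero
  have hαz : ∀ z, D.α ⟨0, 0, z⟩ = a * z := fun z => by rw [hα, hα0, zero_add]
  have hf1 : ∀ x y, y ≠ 0 → D.f ⟨x, y, 0⟩ = D.f ⟨0, y, 0⟩ := fun x y hy => by
    -- Left multiplication by `⟨0, 0, t⟩` shifts the first coordinate by `a * t * y`; for `y ≠ 0`
    -- this `t` moves it to 0.
    have h1 := D.f_mul ⟨0, 0, -x / (a * y)⟩ ⟨x, y, 0⟩
    have h3 : x + a * (-x / (a * y)) * y = 0 := by field_simp; ring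
    rw [center_mul, f_eq, D.f_center, hαz, h3] at h1
    linear_combination -h1
  have hfx : D.f ⟨1, 0, 0⟩ = 0 := by
    have h1 := D.f_mul ⟨1, 0, 0⟩ ⟨0, 1, 0⟩
    rw [mul_first_second, f_eq, hf1 _ 1 one_ne_zero] at h1
    linear_combination -h1
  have hf2 : ∀ x y, D.f ⟨x, y, 0⟩ = D.f ⟨0, y, 0⟩ := fun x y => by
    by_cases hy : y = 0
    · rw [hy, f_first, D.f_center, hfx, zero_mul]
    · exact hf1 x y hy
  have hf3 : ∀ y, D.f ⟨0, y, 0⟩ = D.f ⟨0, 1, 0⟩ * y :=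
    ZMod.eq_mul_of_additive (F := fun y => D.f ⟨0, y, 0⟩) (fun y y' => by
      rw [← f_mul, mul_second, f_eq _ _ _ (_ * _), hf2 (_ * _)])
  have hα1 : ∀ x, D.α ⟨x, 0, 0⟩ = D.α ⟨1, 0, 0⟩ * x :=
    ZMod.eq_mul_of_additive (F := fun x => D.α ⟨x, 0, 0⟩) (fun x x' => by
      rw [← α_mul, mul_first, hα _ _ (_ * _), f_first, hfx, zero_mul, zero_mul, mul_zero,
        add_zero])
  have hα2 : ∀ x y, y ≠ 0 → D.α ⟨x, y, 0⟩ = D.α ⟨0, y, 0⟩ - D.g ⟨0, 0, 1⟩ * x :=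
    fun x y hy => by
      have h1 := D.α_mul ⟨0, 0, -x / (a * y)⟩ ⟨x, y, 0⟩
      have h3 : x + a * (-x / (a * y)) * y = 0 := by field_simp; ring
      have h4 : a * (-x / (a * y)) * y = -x := by field_simp
      rw [center_mul, hα, D.f_center, hαz, h3, g_center] at h1
      linear_combination -h1 + D.g ⟨0, 0, 1⟩ * h4
  have key : ∀ y, y ≠ 0 → D.α ⟨1, 0, 0⟩ = -D.g ⟨0, 0, 1⟩ * (1 + D.α ⟨1, 0, 0⟩ * y) +
      a * (D.g ⟨1, 0, 0⟩ + 1) * y := fun y hy => by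
    have h1 := D.α_mul ⟨1, 0, 0⟩ ⟨0, y, 0⟩
    rw [mul_first_second, hα, hα2 _ y hy] at h1
    linear_combination -h1
  have key1 := key 1 one_ne_zero
  -- `key` is affine in `y`; adding its instances at `1` and `-1` isolates the constant term.
  have key2 := key (-1) (neg_ne_zero.2 one_ne_zero)
  have hgz : D.g ⟨0, 0, 1⟩ = -D.α ⟨1, 0, 0⟩ := by
    refine mul_left_cancel₀ h2 ?_
    linear_combination key1 + key2
  rw [hgz] at key1 key2 hα2
  have hfy : D.f ⟨0, 1, 0⟩ = 1 := by
    have h1 := D.α_mul ⟨0, 1, 0⟩ ⟨1, 0, 0⟩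
    rw [mul_second_first, hα, hα2 _ 1 one_ne_zero] at h1
    refine mul_left_cancel₀ h0 ?_
    linear_combination h1
  simp only [hfy, one_mul] at hf3
  have hα4 : ∀ x y, D.α ⟨x, y, 0⟩ = D.α ⟨0, y, 0⟩ + D.α ⟨1, 0, 0⟩ * x := fun x y => by
    have h1 := D.α_mul ⟨0, y, 0⟩ ⟨x, 0, 0⟩
    rw [mul_second_first, hf3, sub_self, zero_mul, hα1] at h1
    exact h1
  have hgx : ∀ x, D.g ⟨x, 0, 0⟩ = D.g ⟨1, 0, 0⟩ * x :=
    ZMod.eq_mul_of_additive (F := fun x => D.g ⟨x, 0, 0⟩) (fun x x' => by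
      have h1 := D.g_mul ⟨x, 0, 0⟩ ⟨x', 0, 0⟩
      rw [mul_first, f_first, hfx, zero_mul, zero_mul] at h1
      linear_combination h1)
  have hg1 : ∀ x y, D.g ⟨x, y, 0⟩ = D.g ⟨0, y, 0⟩ + D.g ⟨1, 0, 0⟩ * x +
      D.α ⟨1, 0, 0⟩ * x * y := fun x y => by
    have h1 := D.g_mul ⟨0, y, 0⟩ ⟨x, 0, 0⟩
    rw [mul_second_first, hf3, sub_self, zero_mul, hα1 x, hgx x] at h1
    exact h1
  have hη : ∀ y y', D.α ⟨0, y, 0⟩ + D.α ⟨0, y', 0⟩ - D.α ⟨0, y + y', 0⟩ =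
      (a * (D.g ⟨0, y, 0⟩ - y * D.α ⟨0, y, 0⟩) + D.α ⟨1, 0, 0⟩ * D.α ⟨0, y, 0⟩) * y' :=
    fun y y' => by
      have h1 := D.α_mul ⟨0, y, 0⟩ ⟨0, y', 0⟩
      rw [mul_second, hα, hα4] at h1
      linear_combination -h1
  -- The left side of `hη` is symmetric in `y` and `y'`, so the coefficient of `y'` on the right
  -- must be linear in `y`.
  have hκ : ∀ y, a * (D.g ⟨0, y, 0⟩ - y * D.α ⟨0, y, 0⟩) + D.α ⟨1, 0, 0⟩ * D.α ⟨0, y, 0⟩ =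
      (a * (D.g ⟨0, 1, 0⟩ - 1 * D.α ⟨0, 1, 0⟩) + D.α ⟨1, 0, 0⟩ * D.α ⟨0, 1, 0⟩) * y :=
    fun y => by
      have h1 := hη y 1
      have h3 := hη 1 y
      rw [add_comm 1 y] at h3
      linear_combination h3 - h1
  generalize a * (D.g ⟨0, 1, 0⟩ - 1 * D.α ⟨0, 1, 0⟩) +
    D.α ⟨1, 0, 0⟩ * D.α ⟨0, 1, 0⟩ = k at hκ
  have hηq := ZMod.eq_quadratic_of_polarization (F := fun y => D.α ⟨0, y, 0⟩) h2 (k := k)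
    (fun y y' => by rw [hη, hκ])
  refine ⟨D.α ⟨1, 0, 0⟩, D.α ⟨0, 1, 0⟩ + k / 2, k, fun x y z => ⟨?_, ?_, ?_⟩⟩
  · rw [hα, hα4, hηq y]; ring
  · rw [f_eq, hf2, hf3]
  · have h1 := hκ y
    rw [g_eq_add, ha, hgz, hf2, hf3, hg1]
    have h3 := hηq y
    linear_combination h1 + (a * y - D.α ⟨1, 0, 0⟩) * h3 - x * key1

end Solve

end BraceData

/-! ### Isomorphisms and normal forms. -/

namespace BraceData

variable {p : ℕ}

/-- A matrix and a linear form that carry the left translations of `D` to those of `D'`. -/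
structure Intertwines (D D' : BraceData p) (m₁₁ m₁₂ m₂₁ m₂₂ h₁ h₂ : ZMod p) : Prop where
  det_ne_zero : m₁₁ * m₂₂ - m₁₂ * m₂₁ ≠ 0
  α_left : ∀ a, m₂₁ * D.α a = 0
  α_right : ∀ a, D'.α (Heis.linearHom m₁₁ m₁₂ m₂₁ m₂₂ h₁ h₂ a) * m₂₁ = 0
  α_eq : ∀ a, D'.α (Heis.linearHom m₁₁ m₁₂ m₂₁ m₂₂ h₁ h₂ a) * m₂₂ = m₁₁ * D.α a
  f_eq : ∀ a, D'.f (Heis.linearHom m₁₁ m₁₂ m₂₁ m₂₂ h₁ h₂ a) * m₁₁ +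
    D'.g (Heis.linearHom m₁₁ m₁₂ m₂₁ m₂₂ h₁ h₂ a) * m₂₁ = (m₁₁ * m₂₂ - m₁₂ * m₂₁) * D.f a
  g_eq : ∀ a, D'.f (Heis.linearHom m₁₁ m₁₂ m₂₁ m₂₂ h₁ h₂ a) * m₁₂ +
    D'.g (Heis.linearHom m₁₁ m₁₂ m₂₁ m₂₂ h₁ h₂ a) * m₂₂ =
      (m₁₁ * m₂₂ - m₁₂ * m₂₁) * D.g a + h₁ * D.α a

/-- The bilinear data: the left translations are central automorphisms, given by the symmetric
form `diag (s₁, s₂)` and by `c` times the commutator form. -/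
def bilinear (s₁ s₂ c : ZMod p) : BraceData p where
  α _ := 0
  f a := s₁ * a.x + (1 - c) * a.y
  g a := (c - 1) * a.x + s₂ * a.y
  map_α _ _ := by simp
  map_f a b := by simp only [Heis.twistMul]; ring
  map_g a b := by simp only [Heis.twistMul]; ring

/-- The data whose left translations factor through a quotient of the additive abelianization. -/
def quadratic (u w : ZMod p) : BraceData p where
  -- The slope 2 clears the denominator of the coefficient `b * (c - d) / 2`.
  α a := 2 * a.y
  f a := (w + 1) * a.y
  g a := (u - 1) * a.x + (w - u + 2) * a.y ^ 2
  map_α _ _ := by simp only [Heis.twistMul]; ring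
  map_f a b := by simp only [Heis.twistMul]; ring
  map_g a b := by simp only [Heis.twistMul]; ring

/-- The data for which the centre of the additive group acts nontrivially, when `a ≠ 0`. -/
def central (a μ : ZMod p) : BraceData p where
  α v := a * (v.z + μ * v.y ^ 2)
  f v := v.y
  g v := -v.x + a * v.y * (v.z + μ * v.y ^ 2) - 2 * μ * v.y
  map_α _ _ := by simp only [Heis.twistMul]; ring
  map_f _ _ := by simp only [Heis.twistMul]
  map_g _ _ := by simp only [Heis.twistMul]; ring

/-- The bilinear data in normal form: `none` stands for the zero symmetric form and `some d` for
`diag (1, d)`. -/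
def bilinearNormal (s : Option (ZMod p)) (c : ZMod p) : BraceData p :=
  bilinear (s.elim 0 fun _ => 1) (s.getD 0) c

variable [Fact p.Prime] {D D' : BraceData p}

/-- An additive automorphism `ψ` is a brace isomorphism exactly when `ψ λ_a = λ'_{ψ a} ψ`; the
fields of `Intertwines` are the entries of this identity. -/
theorem Intertwines.nonempty_equiv {m₁₁ m₁₂ m₂₁ m₂₂ h₁ h₂ : ZMod p}
    (h : Intertwines D D' m₁₁ m₁₂ m₂₁ m₂₂ h₁ h₂) : Nonempty (D.Carrier ≃+* D'.Carrier) := by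
  let ψ := Heis.linearEquiv m₁₁ m₁₂ m₂₁ m₂₂ h₁ h₂ h.det_ne_zero
  refine nonempty_equiv_of_addEquiv (B := D.Carrier) ψ fun (a b : Heis p) => ?_
  change Heis.linearHom m₁₁ m₁₂ m₂₁ m₂₂ h₁ h₂ (D.mul a b) =
    D'.mul (Heis.linearHom m₁₁ m₁₂ m₂₁ m₂₂ h₁ h₂ a) (Heis.linearHom m₁₁ m₁₂ m₂₁ m₂₂ h₁ h₂ b)
  have e1 := h.α_left a
  have e2 := h.α_right a
  have e3 := h.α_eq a
  have e4 := h.f_eq a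
  have e5 := h.g_eq a
  rw [mul_def D']
  generalize D'.α (Heis.linearHom m₁₁ m₁₂ m₂₁ m₂₂ h₁ h₂ a) = α' at *
  generalize D'.f (Heis.linearHom m₁₁ m₁₂ m₂₁ m₂₂ h₁ h₂ a) = f' at *
  generalize D'.g (Heis.linearHom m₁₁ m₁₂ m₂₁ m₂₂ h₁ h₂ a) = g' at *
  simp only [Heis.linearHom, mul_def, AddMonoidHom.coe_mk, ZeroHom.coe_mk, Heis.mk.injEq]
  refine ⟨?_, ?_, ?_⟩
  · linear_combination -b.x * e2 - b.y * e3
  · linear_combination b.y * e1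
  · linear_combination -b.x * e4 - b.y * e5 + (m₂₁ * a.x + m₂₂ * a.y) * (b.x * e2 + b.y * e3) +
      (m₁₁ * a.x + m₁₂ * a.y) * b.y * e1

theorem exists_intertwines (h2 : (2 : ZMod p) ≠ 0) (φ : D.Carrier ≃+* D'.Carrier) :
    ∃ m₁₁ m₁₂ m₂₁ m₂₂ h₁ h₂ : ZMod p, Intertwines D D' m₁₁ m₁₂ m₂₁ m₂₂ h₁ h₂ := by
  let ψ : Heis p ≃+ Heis p := φ.toAddEquiv
  have hmul : ∀ a b, ψ (D.mul a b) = D'.mul (ψ a) (ψ b) := fun a b => φ.map_mul' a b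
  obtain ⟨m₁₁, m₁₂, m₂₁, m₂₂, h₁, h₂, hψ⟩ : ∃ m₁₁ m₁₂ m₂₁ m₂₂ h₁ h₂ : ZMod p,
      ∀ a, ψ a = Heis.linearHom m₁₁ m₁₂ m₂₁ m₂₂ h₁ h₂ a :=
    ⟨_, _, _, _, _, _, fun a => Heis.addMonoidHom_form h2 ψ.toAddMonoidHom a⟩
  have hdet : m₁₁ * m₂₂ - m₁₂ * m₂₁ ≠ 0 := by
    intro h
    have h1 : ψ ⟨0, 0, 1⟩ = ψ 0 := by
      rw [hψ, hψ]
      simp [Heis.linearHom, h]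
    have h3 := congrArg Heis.z (ψ.injective h1)
    exact one_ne_zero h3
  have key : ∀ a x y, ψ (D.mul a ⟨x, y, 0⟩) = D'.mul (ψ a) (ψ ⟨x, y, 0⟩) :=
    fun a x y => hmul a ⟨x, y, 0⟩
  simp only [hψ] at key
  simp only [mul_def D'] at key
  refine ⟨m₁₁, m₁₂, m₂₁, m₂₂, h₁, h₂, ?_⟩
  have main : ∀ a, m₂₁ * D.α a = 0 ∧
      D'.α (Heis.linearHom m₁₁ m₁₂ m₂₁ m₂₂ h₁ h₂ a) * m₂₁ = 0 ∧
      D'.α (Heis.linearHom m₁₁ m₁₂ m₂₁ m₂₂ h₁ h₂ a) * m₂₂ = m₁₁ * D.α a ∧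
      D'.f (Heis.linearHom m₁₁ m₁₂ m₂₁ m₂₂ h₁ h₂ a) * m₁₁ +
        D'.g (Heis.linearHom m₁₁ m₁₂ m₂₁ m₂₂ h₁ h₂ a) * m₂₁ =
          (m₁₁ * m₂₂ - m₁₂ * m₂₁) * D.f a ∧
      D'.f (Heis.linearHom m₁₁ m₁₂ m₂₁ m₂₂ h₁ h₂ a) * m₁₂ +
        D'.g (Heis.linearHom m₁₁ m₁₂ m₂₁ m₂₂ h₁ h₂ a) * m₂₂ =
          (m₁₁ * m₂₂ - m₁₂ * m₂₁) * D.g a + h₁ * D.α a := by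
    intro a
    have k1 := key a 1 0
    have k2 := key a 0 1
    generalize D'.α (Heis.linearHom m₁₁ m₁₂ m₂₁ m₂₂ h₁ h₂ a) = α' at *
    generalize D'.f (Heis.linearHom m₁₁ m₁₂ m₂₁ m₂₂ h₁ h₂ a) = f' at *
    generalize D'.g (Heis.linearHom m₁₁ m₁₂ m₂₁ m₂₂ h₁ h₂ a) = g' at *
    simp only [Heis.linearHom, mul_def, AddMonoidHom.coe_mk, ZeroHom.coe_mk,
      Heis.mk.injEq] at k1 k2
    obtain ⟨x1, y1, z1⟩ := k1
    obtain ⟨x2, y2, z2⟩ := k2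
    have e1 : m₂₁ * D.α a = 0 := by linear_combination y2
    have e2 : α' * m₂₁ = 0 := by linear_combination -x1
    have e3 : α' * m₂₂ = m₁₁ * D.α a := by linear_combination -x2
    refine ⟨e1, e2, e3, ?_, ?_⟩
    · linear_combination -z1 + (m₂₁ * a.x + m₂₂ * a.y) * e2
    · linear_combination -z2 + (m₂₁ * a.x + m₂₂ * a.y) * e3 + (m₁₁ * a.x + m₁₂ * a.y) * e1
  exact ⟨hdet, fun a => (main a).1, fun a => (main a).2.1, fun a => (main a).2.2.1,
    fun a => (main a).2.2.2.1, fun a => (main a).2.2.2.2⟩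

theorem exists_bilinearNormal (h2 : (2 : ZMod p) ≠ 0) {c₁ c₂ d₁ d₂ : ZMod p}
    (hα : ∀ a, D.α a = 0) (hf : ∀ a, D.f a = c₁ * a.x + c₂ * a.y)
    (hg : ∀ a, D.g a = d₁ * a.x + d₂ * a.y) :
    ∃ (s : Option (ZMod p)) (c : ZMod p), Nonempty (D.Carrier ≃+* (bilinearNormal s c).Carrier) := by
  -- The mixed coefficients split into a symmetric part `s` and an alternating part `1 - c`.
  obtain ⟨s, c, hc, hd⟩ : ∃ s c, c₂ = s - c + 1 ∧ d₁ = s + c - 1 :=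
    ⟨(c₂ + d₁) / 2, (d₁ - c₂ + 2) / 2, by field_simp; ring, by field_simp; ring⟩
  subst hc hd
  by_cases hS : ∃ v₁ v₂ : ZMod p, c₁ * v₁ ^ 2 + 2 * s * v₁ * v₂ + d₂ * v₂ ^ 2 ≠ 0
  · obtain ⟨v₁, v₂, hv⟩ := hS
    refine ⟨some (c₁ * d₂ - s ^ 2), c, ?_⟩
    -- The columns are `v` and a vector orthogonal to it for the symmetric form `S`. The determinant
    -- is `S(v, v)` and the second vector has value `det S * S(v, v)`, so dividing by the
    -- determinant gives `diag (1, det S)`.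
    have h : Intertwines (bilinearNormal (some (c₁ * d₂ - s ^ 2)) c) D
        v₁ (-(s * v₁ + d₂ * v₂)) v₂ (c₁ * v₁ + s * v₂) 0 0 := by
      refine ⟨?_, ?_, ?_, ?_, ?_, ?_⟩
      · intro h; apply hv; linear_combination h
      all_goals
        intro a
        simp only [hα, hf, hg, bilinearNormal, bilinear, Heis.linearHom, AddMonoidHom.coe_mk,
          ZeroHom.coe_mk, Option.elim, Option.getD]
        ring
    exact h.nonempty_equiv.map RingEquiv.symm
  · push Not at hS
    have h1 : c₁ = 0 := by simpa using hS 1 0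
    have h3 : d₂ = 0 := by simpa using hS 0 1
    have h4 : s = 0 := by
      have := hS 1 1
      rw [h1, h3] at this
      refine (mul_eq_zero.1 (?_ : 2 * s = 0)).resolve_left h2
      linear_combination this
    have h5 : D = bilinearNormal none c := by
      ext a
      · simp [hα, bilinearNormal, bilinear]
      · simp only [hf, bilinearNormal, bilinear, Option.elim, h1, h4]; ring
      · simp [hg, bilinearNormal, bilinear, h3, h4]
    exact ⟨none, c, h5 ▸ ⟨RingEquiv.refl _⟩⟩

theorem nonempty_equiv_quadratic (h2 : (2 : ZMod p) ≠ 0) {b c d e : ZMod p} (hb : b ≠ 0)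
    (hα : ∀ a, D.α a = b * a.y) (hf : ∀ a, D.f a = c * a.y)
    (hg : ∀ a, D.g a = d * a.x + e * a.y + b * (c - d) / 2 * a.y ^ 2) :
    Nonempty (D.Carrier ≃+* (quadratic (d + 1) (c - 1)).Carrier) := by
  -- The entry `2 / b` normalises the slope of `α`; the linear form absorbs the term `e * a.y` of
  -- `g`.
  have h : Intertwines D (quadratic (d + 1) (c - 1)) (2 / b) 0 0 1 (-(2 / b * e / b)) 0 := by
    refine ⟨?_, ?_, ?_, ?_, ?_, ?_⟩
    · simpa using ⟨h2, hb⟩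
    all_goals
      intro a
      simp only [hα, hf, hg, quadratic, Heis.linearHom, AddMonoidHom.coe_mk, ZeroHom.coe_mk]
      field_simp
      try ring
  exact h.nonempty_equiv

/-- A linear form removes `b` and `n`. The matrix `diag (m₁, m₂)` changes `a` by the square `m₂ ^
2`, while the free `m₁` rescales `k`; `haa` and `hμ` compare the coefficients of `z` and `y ^ 2` in
`α`. -/
theorem nonempty_equiv_central (h2 : (2 : ZMod p) ≠ 0) {a b n k : ZMod p}
    (ha : a ≠ 0) (hα : ∀ v, D.α v = a * v.z + b * v.x + n * v.y - k / 2 * v.y ^ 2)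
    (hf : ∀ v, D.f v = v.y)
    (hg : ∀ v, a * D.g v = -(a + b ^ 2) * v.x + a * b * v.x * v.y - a * b * v.z +
      a ^ 2 * v.y * v.z + k * v.y + (a * v.y - b) * (n * v.y - k / 2 * v.y ^ 2))
    {a' μ m₁ m₂ : ZMod p} (hm₁ : m₁ ≠ 0) (hm₂ : m₂ ≠ 0) (haa : a' * m₂ ^ 2 = a)
    (hμ : 2 * (a' * μ * m₂ ^ 3) = -(k * m₁)) :
    Nonempty (D.Carrier ≃+* (central a' μ).Carrier) := by
  have ha' : a' ≠ 0 := by rintro rfl; simp at haa; exact ha haa.symm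
  have hk : k = -(2 * (a' * μ * m₂ ^ 3)) / m₁ := by rw [hμ]; field_simp
  subst haa hk
  have h : Intertwines D (central a' μ) m₁ 0 0 m₂ (m₁ * b / (a' * m₂)) (m₁ * n / (a' * m₂)) := by
    refine ⟨?_, ?_, ?_, ?_, ?_, ?_⟩
    · simpa using ⟨hm₁, hm₂⟩
    · simp
    · simp
    · intro v
      simp only [hα, central, Heis.linearHom, AddMonoidHom.coe_mk, ZeroHom.coe_mk]
      field_simp
      ring
    · intro v
      simp only [hf, central, Heis.linearHom, AddMonoidHom.coe_mk, ZeroHom.coe_mk]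
      ring
    · intro v
      have hgv := eq_div_of_mul_eq ha ((mul_comm _ _).trans (hg v))
      rw [hgv, hα]
      simp only [central, Heis.linearHom, AddMonoidHom.coe_mk, ZeroHom.coe_mk]
      field_simp
      ring
  exact h.nonempty_equiv

/-- Every isomorphism class contains data in normal form. -/
theorem exists_normal_form (h2 : (2 : ZMod p) ≠ 0) {ν : ZMod p} (hν : ¬IsSquare ν)
    (hsq : ∀ a : ZMod p, ¬IsSquare a → IsSquare (a / ν)) (D : BraceData p) :
    (∃ (s : Option (ZMod p)) (c : ZMod p), Nonempty (D.Carrier ≃+* (bilinearNormal s c).Carrier)) ∨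
      (∃ u w : ZMod p, Nonempty (D.Carrier ≃+* (quadratic u w).Carrier)) ∨
      ∃ i j : Bool, Nonempty (D.Carrier ≃+* (central (cond i ν 1) (cond j 1 0)).Carrier) := by
  have hν0 : ν ≠ 0 := by rintro rfl; exact hν (IsSquare.zero)
  by_cases h0 : D.α ⟨0, 0, 1⟩ = 0
  · obtain ⟨b, c₁, c₂, d₁, d₂, hbc, h⟩ := D.eq_of_α_center_eq_zero h2 h0
    by_cases hb : b = 0
    · subst hb
      exact Or.inl (exists_bilinearNormal (c₁ := c₁) (c₂ := c₂) (d₁ := d₁) (d₂ := d₂) h2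
        (fun a => by rw [(h a.x a.y a.z).1, zero_mul]) (fun a => (h a.x a.y a.z).2.1)
        (fun a => by rw [(h a.x a.y a.z).2.2]; ring))
    · obtain rfl := (mul_eq_zero.1 hbc).resolve_left hb
      exact Or.inr (Or.inl ⟨_, _, nonempty_equiv_quadratic (c := c₂) (d := d₁) (e := d₂) h2 hb
        (fun a => (h a.x a.y a.z).1) (fun a => by rw [(h a.x a.y a.z).2.1]; ring)
        (fun a => (h a.x a.y a.z).2.2)⟩)
  · obtain ⟨b, n, k, h⟩ := D.eq_of_α_center_ne_zero h2 rfl h0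
    refine Or.inr (Or.inr ?_)
    generalize D.α ⟨0, 0, 1⟩ = a at h h0
    obtain ⟨i, m₂, hi⟩ : ∃ (i : Bool) (m₂ : ZMod p), cond i ν 1 * m₂ ^ 2 = a := by
      by_cases hs : IsSquare a
      · obtain ⟨r, rfl⟩ := hs
        exact ⟨false, r, by simp [pow_two]⟩
      · obtain ⟨r, hr⟩ := hsq a hs
        refine ⟨true, r, ?_⟩
        rw [pow_two, ← hr, cond_true, mul_div_cancel₀ _ hν0]
    have hm₂ : m₂ ≠ 0 := by
      rintro rfl
      rw [zero_pow two_ne_zero, mul_zero] at hi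
      exact h0 hi.symm
    have hi0 : cond i ν 1 ≠ 0 := by cases i <;> simp [hν0]
    obtain ⟨j, m₁, hm₁, hj⟩ : ∃ (j : Bool) (m₁ : ZMod p), m₁ ≠ 0 ∧
        2 * (cond i ν 1 * cond j 1 0 * m₂ ^ 3) = -(k * m₁) := by
      by_cases hk : k = 0
      · exact ⟨false, 1, one_ne_zero, by simp [hk]⟩
      · refine ⟨true, -(2 * (cond i ν 1 * m₂ ^ 3)) / k, ?_, ?_⟩
        · simp [h2, hi0, hm₂, hk]
        · rw [cond_true]; field_simp
    exact ⟨i, j, nonempty_equiv_central h2 h0 (fun v => (h v.x v.y v.z).1)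
      (fun v => (h v.x v.y v.z).2.1) (fun v => (h v.x v.y v.z).2.2) hm₁ hm₂ hi hj⟩

end BraceData

/-! ### The multiplicative groups of the models. -/

namespace BraceData

variable {p : ℕ} [Fact p.Prime] {D : BraceData p}

theorem nonempty_mulEquiv_heis (φ : Heis p → Heis p)
    (hφ : ∀ a b, φ (D.mul a b) = φ a + φ b) (h0 : ∀ a, φ a = 0 → a = 0) :
    Nonempty (D.Carrier ≃* Multiplicative (Heis p)) := by
  let Φ : D.Carrier →* Multiplicative (Heis p) :=
    MonoidHom.mk' (fun a : Heis p => .ofAdd (φ a)) fun (a b : Heis p) =>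
      congrArg Multiplicative.ofAdd (hφ a b)
  have hinj : Function.Injective Φ := (injective_iff_map_eq_one Φ).2 fun a ha => h0 a ha
  have hfin : Finite D.Carrier := inferInstanceAs (Finite (Heis p))
  exact ⟨MulEquiv.ofBijective Φ ((Nat.bijective_iff_injective_and_card Φ).2 ⟨hinj, rfl⟩)⟩

theorem nonempty_mulEquiv_cube (ξ φ : Heis p → ZMod p)
    (hξ : ∀ a b, ξ (D.mul a b) = ξ a + ξ b)
    (hφ : ∀ a b, φ (D.mul a b) = φ a + φ b)
    (h0 : ∀ a : Heis p, a.y = 0 → ξ a = 0 → φ a = 0 → a = 0) :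
    Nonempty (D.Carrier ≃* ElementaryAbelianCube p) := by
  let Φ : D.Carrier →* ElementaryAbelianCube p :=
    MonoidHom.mk' (fun a : Heis p => ![.ofAdd (ξ a), .ofAdd a.y, .ofAdd (φ a)])
      fun (a b : Heis p) => by
        change ![Multiplicative.ofAdd (ξ (D.mul a b)), .ofAdd (D.mul a b).y,
          .ofAdd (φ (D.mul a b))] = _
        rw [hξ, hφ]
        funext i
        fin_cases i <;> rfl
  have hinj : Function.Injective Φ := (injective_iff_map_eq_one Φ).2 fun a ha =>
    h0 a (congrFun ha 1) (congrFun ha 0) (congrFun ha 2)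
  have hfin : Finite D.Carrier := inferInstanceAs (Finite (Heis p))
  refine ⟨MulEquiv.ofBijective Φ ((Nat.bijective_iff_injective_and_card Φ).2 ⟨hinj, ?_⟩)⟩
  change Nat.card (Heis p) = _
  rw [Heis.nat_card]
  simp

/-- The symmetric part is the polarisation of `s₁ / 2 * x ^ 2 + s₂ / 2 * y ^ 2`. Subtracting this
from `z` leaves `c` times the commutator form. -/
theorem bilinear_mulEquiv_heis (h2 : (2 : ZMod p) ≠ 0) (s₁ s₂ : ZMod p) {c : ZMod p}
    (hc : c ≠ 0) : Nonempty ((bilinear s₁ s₂ c).Carrier ≃* Multiplicative (Heis p)) := by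
  refine nonempty_mulEquiv_heis
    (fun a => ⟨a.x, a.y, (a.z - s₁ / 2 * a.x ^ 2 - s₂ / 2 * a.y ^ 2) / c⟩) (fun a b => ?_) ?_
  · ext <;> simp only [mul_def, bilinear, Heis.add_x, Heis.add_y, Heis.add_z]
    · ring
    · field_simp; ring
  · rintro ⟨x, y, z⟩ h
    simp only [Heis.zero_def, Heis.mk.injEq] at h ⊢
    obtain ⟨rfl, rfl, hz⟩ := h
    refine ⟨rfl, rfl, ?_⟩
    simpa [hc] using hz

theorem bilinear_mulEquiv_cube (h2 : (2 : ZMod p) ≠ 0) (s₁ s₂ : ZMod p) :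
    Nonempty ((bilinear s₁ s₂ 0).Carrier ≃* ElementaryAbelianCube p) := by
  refine nonempty_mulEquiv_cube
    (fun a => a.x) (fun a => a.z - s₁ / 2 * a.x ^ 2 - s₂ / 2 * a.y ^ 2)
    (fun a b => ?_) (fun a b => ?_) ?_
  · simp only [mul_def, bilinear]; ring
  · simp only [mul_def, bilinear]; field_simp; ring
  · rintro ⟨x, y, z⟩ rfl rfl hz
    simpa [Heis.zero_def] using hz

/-- With the additive coordinate `ξ = x - y ^ 2`, the product adds `w * y * ξ' + u * ξ * y' + w * (y
^ 2 * y' + y * y' ^ 2)` to `z + z'`. The cubic part is the coboundary of `w / 3 * y ^ 3`, the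
symmetric part that of `(w + u) / 2 * ξ * y`, and the alternating part has coefficient `(u - w) /
2`. -/
theorem quadratic_mulEquiv_heis (h2 : (2 : ZMod p) ≠ 0) (h3 : (3 : ZMod p) ≠ 0) {u w : ZMod p}
    (huw : u - w ≠ 0) : Nonempty ((quadratic u w).Carrier ≃* Multiplicative (Heis p)) := by
  refine nonempty_mulEquiv_heis
    (fun a => ⟨a.x - a.y ^ 2, a.y,
      (a.z - w / 3 * a.y ^ 3 - (w + u) / 2 * (a.x - a.y ^ 2) * a.y) / ((u - w) / 2)⟩)
    (fun a b => ?_) ?_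
  · ext <;> simp only [mul_def, quadratic, Heis.add_x, Heis.add_y, Heis.add_z]
    · ring
    · field_simp; ring
  · rintro ⟨x, y, z⟩ h
    simp only [Heis.zero_def, Heis.mk.injEq] at h ⊢
    obtain ⟨hx, rfl, hz⟩ := h
    obtain rfl : x = 0 := by simpa using hx
    refine ⟨rfl, rfl, ?_⟩
    simpa [huw, h2] using hz

theorem quadratic_mulEquiv_cube (h3 : (3 : ZMod p) ≠ 0) (w : ZMod p) :
    Nonempty ((quadratic w w).Carrier ≃* ElementaryAbelianCube p) := by
  refine nonempty_mulEquiv_cube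
    (fun a => a.x - a.y ^ 2) (fun a => a.z - w / 3 * a.y ^ 3 - w * (a.x - a.y ^ 2) * a.y)
    (fun a b => ?_) (fun a b => ?_) ?_
  · simp only [mul_def, quadratic]; ring
  · simp only [mul_def, quadratic]; field_simp; ring
  · rintro ⟨x, y, z⟩ rfl hx hz
    obtain rfl : x = 0 := by simpa using hx
    simpa [Heis.zero_def] using hz

/-- Here `α` and `y` are the two additive coordinates and `x` becomes the central one: the product
adds `α * y'` to it, and `2 * x - α * y` makes this alternating. -/
theorem central_mulEquiv_heis (h2 : (2 : ZMod p) ≠ 0) {a : ZMod p} (ha : a ≠ 0) (μ : ZMod p) :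
    Nonempty ((central a μ).Carrier ≃* Multiplicative (Heis p)) := by
  refine nonempty_mulEquiv_heis
    (fun v => ⟨a * (v.z + μ * v.y ^ 2), v.y, 2 * v.x - a * (v.z + μ * v.y ^ 2) * v.y⟩)
    (fun v v' => ?_) ?_
  · ext <;> simp only [mul_def, central, Heis.add_x, Heis.add_y, Heis.add_z] <;> ring
  · rintro ⟨x, y, z⟩ h
    simp only [Heis.zero_def, Heis.mk.injEq] at h ⊢
    obtain ⟨hz, rfl, hx⟩ := h
    have hz' : z = 0 := by simpa [ha] using hz
    subst hz'
    exact ⟨by simpa [h2] using hx, rfl, rfl⟩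

end BraceData

theorem Heis.isEmpty_mulEquiv_cube {p : ℕ} [Fact p.Prime] (h2 : (2 : ZMod p) ≠ 0) :
    IsEmpty (Multiplicative (Heis p) ≃* ElementaryAbelianCube p) := by
  refine ⟨fun e => h2 ?_⟩
  have h : Multiplicative.ofAdd (⟨1, 0, 0⟩ : Heis p) * .ofAdd ⟨0, 1, 0⟩ =
      .ofAdd ⟨0, 1, 0⟩ * .ofAdd ⟨1, 0, 0⟩ := by
    apply e.injective
    rw [map_mul, map_mul, mul_comm]
  have h1 : ((⟨1, 0, 0⟩ : Heis p) + ⟨0, 1, 0⟩).z = ((⟨0, 1, 0⟩ : Heis p) + ⟨1, 0, 0⟩).z :=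
    congrArg Heis.z (congrArg Multiplicative.toAdd h)
  simp only [Heis.add_z] at h1
  linear_combination h1

/-! ### The models are pairwise non-isomorphic. -/

namespace BraceData

variable {p : ℕ} [Fact p.Prime]

theorem bilinear_injective (h2 : (2 : ZMod p) ≠ 0) {s s' : Option (ZMod p)} {c c' : ZMod p}
    (h : Nonempty ((bilinearNormal s c).Carrier ≃+* (bilinearNormal s' c').Carrier)) :
    s = s' ∧ c = c' := by
  have key : ∀ {s₁ s₂ c s₁' s₂' c' : ZMod p},
      Nonempty ((bilinear s₁ s₂ c).Carrier ≃+* (bilinear s₁' s₂' c').Carrier) → c = c' ∧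
      (s₁' = 0 → s₂' = 0 → s₁ = 0) ∧ s₁ * s₂ = s₁' * s₂' := by
    rintro s₁ s₂ c s₁' s₂' c' ⟨φ⟩
    obtain ⟨m₁₁, m₁₂, m₂₁, m₂₂, h₁, h₃, hd, -, -, -, hf, hg⟩ := exists_intertwines h2 φ
    have f1 := hf ⟨1, 0, 0⟩
    have f2 := hf ⟨0, 1, 0⟩
    have g1 := hg ⟨1, 0, 0⟩
    have g2 := hg ⟨0, 1, 0⟩
    simp only [bilinear, Heis.linearHom, AddMonoidHom.coe_mk, ZeroHom.coe_mk] at f1 f2 g1 g2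
    -- The intertwining relation is `det M * β = Mᵀ β' M` for the bilinear forms. Its alternating
    -- part preserves `c`; the determinant of its symmetric part preserves `s₁ * s₂`.
    have hc : c = c' := by
      refine mul_left_cancel₀ h2 (mul_left_cancel₀ hd ?_)
      linear_combination f2 - g1
    subst hc
    refine ⟨rfl, ?_, ?_⟩
    · rintro rfl rfl
      refine (mul_eq_zero.1 (?_ : (m₁₁ * m₂₂ - m₁₂ * m₂₁) * s₁ = 0)).resolve_left hd
      linear_combination -f1
    · refine mul_left_cancel₀ (pow_ne_zero 2 hd) ?_
      have hx : s₁' * m₁₁ * m₁₂ + s₂' * m₂₁ * m₂₂ = 0 := by linear_combination g1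
      have e1 : (m₁₁ * m₂₂ - m₁₂ * m₂₁) * s₁ = s₁' * m₁₁ ^ 2 + s₂' * m₂₁ ^ 2 := by
        linear_combination -f1
      have e2 : (m₁₁ * m₂₂ - m₁₂ * m₂₁) * s₂ = s₁' * m₁₂ ^ 2 + s₂' * m₂₂ ^ 2 := by
        linear_combination -g2
      linear_combination (m₁₁ * m₂₂ - m₁₂ * m₂₁) * s₂ * e1 +
        (s₁' * m₁₁ ^ 2 + s₂' * m₂₁ ^ 2) * e2 +
        (s₁' * m₁₁ * m₁₂ + s₂' * m₂₁ * m₂₂) * hx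
  have k1 := key h
  have k2 := key (h.map RingEquiv.symm)
  refine ⟨?_, k1.1⟩
  cases s <;> cases s'
  · rfl
  · simp at k2
  · simp at k1
  · simpa using k1.2.2

theorem quadratic_injective (h2 : (2 : ZMod p) ≠ 0) {u w u' w' : ZMod p}
    (h : Nonempty ((quadratic u w).Carrier ≃+* (quadratic u' w').Carrier)) :
    u = u' ∧ w = w' := by
  obtain ⟨φ⟩ := h
  obtain ⟨m₁₁, m₁₂, m₂₁, m₂₂, h₁, h₃, hd, hα, -, -, hf, hg⟩ := exists_intertwines h2 φ
  have hm : m₂₁ = 0 := by simpa [quadratic, h2] using hα ⟨0, 1, 0⟩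
  subst hm
  have f2 := hf ⟨0, 1, 0⟩
  have g1 := hg ⟨1, 0, 0⟩
  simp only [quadratic, Heis.linearHom, AddMonoidHom.coe_mk, ZeroHom.coe_mk] at f2 g1
  constructor
  · refine mul_left_cancel₀ hd ?_
    linear_combination -g1
  · refine mul_left_cancel₀ hd ?_
    linear_combination -f2

theorem central_injective (h2 : (2 : ZMod p) ≠ 0) {ν : ZMod p} (hν : ¬IsSquare ν) {i j i' j' : Bool}
    (h : Nonempty ((central (cond i ν 1) (cond j 1 0)).Carrier ≃+*
      (central (cond i' ν 1) (cond j' 1 0)).Carrier)) :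
    i = i' ∧ j = j' := by
  have hν0 : ν ≠ 0 := by rintro rfl; exact hν IsSquare.zero
  have key : ∀ {a μ a' μ' : ZMod p}, a ≠ 0 → a' ≠ 0 →
      Nonempty ((central a μ).Carrier ≃+* (central a' μ').Carrier) →
      (∃ r, a = a' * r ^ 2) ∧ (μ' = 0 → μ = 0) := by
    rintro a μ a' μ' ha ha' ⟨φ⟩
    obtain ⟨m₁₁, m₁₂, m₂₁, m₂₂, h₁, h₃, hd, hα, -, hα', -, -⟩ := exists_intertwines h2 φ
    have hm : m₂₁ = 0 := by simpa [central, ha] using hα ⟨0, 0, 1⟩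
    subst hm
    have hm₁ : m₁₁ ≠ 0 := by rintro rfl; simp at hd
    have k1 := hα' ⟨0, 0, 1⟩
    have k2 := hα' ⟨0, 1, 0⟩
    have k3 := hα' ⟨0, -1, 0⟩
    simp only [central, Heis.linearHom, AddMonoidHom.coe_mk, ZeroHom.coe_mk] at k1 k2 k3
    refine ⟨⟨m₂₂, mul_left_cancel₀ hm₁ ?_⟩, ?_⟩
    · linear_combination -k1
    · rintro rfl
      refine (mul_eq_zero.1 (?_ : (2 * m₁₁ * a) * μ = 0)).resolve_left
        (mul_ne_zero (mul_ne_zero h2 hm₁) ha)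
      -- Adding the values at `y = 1` and `y = -1` cancels the contribution of the linear form and
      -- keeps the quadratic term.
      linear_combination -k2 - k3
  have hc : ∀ i : Bool, cond i ν 1 ≠ 0 := by intro i; cases i <;> simp [hν0]
  have k1 := key (hc _) (hc _) h
  have k2 := key (hc _) (hc _) (h.map RingEquiv.symm)
  constructor
  · cases i <;> cases i'
    · rfl
    · obtain ⟨r, hr⟩ := k2.1
      exact absurd ⟨r, by simpa [pow_two] using hr⟩ hν
    · obtain ⟨r, hr⟩ := k1.1
      exact absurd ⟨r, by simpa [pow_two] using hr⟩ hν
    · rfl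
  · cases j <;> cases j'
    · rfl
    · simpa using k2.2
    · simpa using k1.2
    · rfl

/-- A nonzero `α` forces `m₂₁ = 0`; where `α` is nonzero but the other `α` vanishes at the image,
also `m₁₁ = 0`, making the matrix singular. The next two lemmas use the same contradiction. -/
theorem quadratic_not_equiv_bilinear (h2 : (2 : ZMod p) ≠ 0) (u w s₁ s₂ c : ZMod p) :
    ¬Nonempty ((quadratic u w).Carrier ≃+* (bilinear s₁ s₂ c).Carrier) := by
  rintro ⟨φ⟩
  obtain ⟨m₁₁, m₁₂, m₂₁, m₂₂, h₁, h₃, hd, hα, -, hα', -, -⟩ := exists_intertwines h2 φ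
  have k1 : m₂₁ = 0 := by simpa [quadratic, h2] using hα ⟨0, 1, 0⟩
  have k2 : m₁₁ = 0 := by simpa [quadratic, bilinear, h2] using hα' ⟨0, 1, 0⟩
  simp [k1, k2] at hd

theorem central_not_equiv_bilinear (h2 : (2 : ZMod p) ≠ 0) {a : ZMod p} (ha : a ≠ 0)
    (μ s₁ s₂ c : ZMod p) :
    ¬Nonempty ((central a μ).Carrier ≃+* (bilinear s₁ s₂ c).Carrier) := by
  rintro ⟨φ⟩
  obtain ⟨m₁₁, m₁₂, m₂₁, m₂₂, h₁, h₃, hd, hα, -, hα', -, -⟩ := exists_intertwines h2 φ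
  have k1 : m₂₁ = 0 := by simpa [central, ha] using hα ⟨0, 0, 1⟩
  have k2 : m₁₁ = 0 := by simpa [central, bilinear, ha] using hα' ⟨0, 0, 1⟩
  simp [k1, k2] at hd

theorem central_not_equiv_quadratic (h2 : (2 : ZMod p) ≠ 0) {a : ZMod p} (ha : a ≠ 0)
    (μ u w : ZMod p) :
    ¬Nonempty ((central a μ).Carrier ≃+* (quadratic u w).Carrier) := by
  rintro ⟨φ⟩
  obtain ⟨m₁₁, m₁₂, m₂₁, m₂₂, h₁, h₃, hd, hα, -, hα', -, -⟩ := exists_intertwines h2 φ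
  have k1 : m₂₁ = 0 := by simpa [central, ha] using hα ⟨0, 0, 1⟩
  have k2 : m₁₁ = 0 := by
    simpa [central, quadratic, Heis.linearHom, ha] using hα' ⟨0, 0, 1⟩
  simp [k1, k2] at hd

end BraceData

/-! ### Counting isomorphism classes. -/

/-- The models live in the lowest universe; lifting provides representatives in `Type u`. -/
instance ULift.skewBrace {B : Type w} [SkewBrace B] : SkewBrace (ULift.{u} B) where
  mul_add_eq a b c := congrArg ULift.up (SkewBrace.mul_add_eq a.down b.down c.down)

/-- The universe lift of a skew brace is isomorphic to it. -/
def ULift.skewBraceEquiv (B : Type w) [SkewBrace B] : ULift.{u} B ≃+* B where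
  toEquiv := Equiv.ulift
  map_mul' _ _ := rfl
  map_add' _ _ := rfl

/-- Counting skew braces by a family of unitriangular data that represents every isomorphism
class exactly once. -/
theorem SkewBraceClasses.nat_card_eq {N : Type v} {G : Type w} [Group N] [Group G] {p : ℕ}
    (e : N ≃* Multiplicative (Heis p)) {ι : Type*} (model : ι → BraceData p)
    (hG : ∀ i, Nonempty ((model i).Carrier ≃* G))
    (hinj : ∀ i j, Nonempty ((model i).Carrier ≃+* (model j).Carrier) → i = j)
    (hsurj : ∀ (B : Type u) [SkewBrace B], Nonempty (B ≃+ Heis p) → Nonempty (B ≃* G) →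
      ∃ i, Nonempty (B ≃+* (model i).Carrier)) :
    Nat.card (SkewBraceClasses.{u} N G) = Nat.card ι := by
  let eN : Additive N ≃+ Heis p := (MulEquiv.toAdditive e).trans (AddEquiv.additiveMultiplicative _)
  let rep : ι → SkewBraceOfType.{u} N G := fun i =>
    { carrier := ULift.{u} (model i).Carrier
      type_iso := ⟨(ULift.skewBraceEquiv (model i).Carrier).toAddEquiv.trans eN.symm⟩
      structure_iso := (hG i).map (ULift.skewBraceEquiv (model i).Carrier).toMulEquiv.trans }
  refine (Nat.card_eq_of_bijective
    (fun i => (Quotient.mk (SkewBraceOfType.isoSetoid N G) (rep i) : SkewBraceClasses N G))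
    ⟨fun i j hij => ?_, fun q => ?_⟩).symm
  · obtain ⟨φ⟩ : Nonempty (ULift.{u} (model i).Carrier ≃+* ULift.{u} (model j).Carrier) :=
      Quotient.exact hij
    exact hinj i j ⟨((ULift.skewBraceEquiv _).symm.trans φ).trans (ULift.skewBraceEquiv _)⟩
  · induction q using Quotient.inductionOn with
    | h A =>
      obtain ⟨i, ⟨φ⟩⟩ := hsurj A.carrier (A.type_iso.map fun f => f.trans eN) A.structure_iso
      refine ⟨i, Quotient.sound ?_⟩
      exact ⟨(ULift.skewBraceEquiv _).trans φ.symm⟩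

section Classification

variable {p : ℕ} [Fact p.Prime]

theorem ZMod.isSquare_div_of_not_isSquare {ν a : ZMod p} (hν : ¬IsSquare ν) (ha : ¬IsSquare a) :
    IsSquare (a / ν) := by
  have hν0 : ν ≠ 0 := by rintro rfl; exact hν IsSquare.zero
  have ha0 : a ≠ 0 := by rintro rfl; exact ha IsSquare.zero
  have h : quadraticChar (ZMod p) (a * ν) = 1 := by
    rw [map_mul, quadraticChar_neg_one_iff_not_isSquare.2 ha,
      quadraticChar_neg_one_iff_not_isSquare.2 hν]
    rfl
  obtain ⟨r, hr⟩ := (quadraticChar_one_iff_isSquare (mul_ne_zero ha0 hν0)).1 h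
  refine ⟨r / ν, ?_⟩
  field_simp
  rw [hr, pow_two]

namespace BraceData

/-- The labels of the isomorphism classes with Heisenberg multiplicative group. -/
abbrev HeisIndex (p : ℕ) : Type :=
  (Option (ZMod p) × (ZMod p)ˣ) ⊕ (ZMod p × (ZMod p)ˣ) ⊕ (Bool × Bool)

/-- The labels of the isomorphism classes with elementary abelian multiplicative group. -/
abbrev CubeIndex (p : ℕ) : Type := Option (ZMod p) ⊕ ZMod p

/-- Representatives with Heisenberg multiplicative group; `ν` is meant to be a nonsquare. -/
def heisModel (ν : ZMod p) : HeisIndex p → BraceData p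
  | .inl (s, c) => bilinearNormal s c
  | .inr (.inl (w, v)) => quadratic (w + v) w
  | .inr (.inr (i, j)) => central (cond i ν 1) (cond j 1 0)

/-- Representatives with elementary abelian multiplicative group. -/
def cubeModel : CubeIndex p → BraceData p
  | .inl s => bilinearNormal s 0
  | .inr w => quadratic w w

theorem nat_card_heisIndex : Nat.card (HeisIndex p) = 2 * p ^ 2 - p + 3 := by
  have hp := (Fact.out : p.Prime).one_lt
  obtain ⟨q, rfl⟩ : ∃ q, p = q + 1 := ⟨p - 1, by omega⟩
  have h : Nat.card (ZMod (q + 1))ˣ = q := by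
    rw [Nat.card_eq_fintype_card, ZMod.card_units_eq_totient, Nat.totient_prime Fact.out,
      Nat.add_sub_cancel]
  rw [Nat.card_sum, Nat.card_sum, Nat.card_prod, Nat.card_prod, Nat.card_prod, h,
    Finite.card_option, Nat.card_zmod, Nat.card_eq_fintype_card, Fintype.card_bool]
  -- Splitting off `p = q + 1` makes the truncated subtraction exact.
  have h1 : 2 * (q + 1) ^ 2 = (2 * q ^ 2 + 3 * q + 1) + (q + 1) := by ring
  rw [h1, Nat.add_sub_cancel]
  ring

theorem nat_card_cubeIndex : Nat.card (CubeIndex p) = 2 * p + 1 := by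
  rw [Nat.card_sum, Finite.card_option, Nat.card_zmod]
  ring

theorem heisModel_mulEquiv (hp3 : 3 < p) {ν : ZMod p} (hν : ν ≠ 0) (i : HeisIndex p) :
    Nonempty ((heisModel ν i).Carrier ≃* Multiplicative (Heis p)) := by
  have h2 := ZMod.two_ne_zero_of_three_lt hp3
  have h3 := ZMod.three_ne_zero_of_three_lt hp3
  match i with
  | .inl (s, c) => exact bilinear_mulEquiv_heis h2 _ _ c.ne_zero
  | .inr (.inl (w, v)) => exact quadratic_mulEquiv_heis h2 h3 (by simp)
  | .inr (.inr (i, j)) => exact central_mulEquiv_heis h2 (by cases i <;> simp [hν]) _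

theorem cubeModel_mulEquiv (hp3 : 3 < p) (i : CubeIndex p) :
    Nonempty ((cubeModel i).Carrier ≃* ElementaryAbelianCube p) := by
  match i with
  | .inl s => exact bilinear_mulEquiv_cube (ZMod.two_ne_zero_of_three_lt hp3) _ _
  | .inr w => exact quadratic_mulEquiv_cube (ZMod.three_ne_zero_of_three_lt hp3) w

theorem heisModel_injective (h2 : (2 : ZMod p) ≠ 0) {ν : ZMod p} (hν : ¬IsSquare ν)
    (i j : HeisIndex p)
    (h : Nonempty ((heisModel ν i).Carrier ≃+* (heisModel ν j).Carrier)) : i = j := by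
  have hν0 : ν ≠ 0 := by rintro rfl; exact hν IsSquare.zero
  have hc : ∀ i : Bool, cond i ν 1 ≠ 0 := by intro i; cases i <;> simp [hν0]
  match i, j with
  | .inl (s, c), .inl (s', c') =>
    obtain ⟨rfl, hcc⟩ := bilinear_injective h2 h
    rw [Units.ext hcc]
  | .inl _, .inr (.inl _) =>
    exact absurd (h.map RingEquiv.symm) (quadratic_not_equiv_bilinear h2 _ _ _ _ _)
  | .inl _, .inr (.inr _) =>
    exact absurd (h.map RingEquiv.symm) (central_not_equiv_bilinear h2 (hc _) _ _ _ _)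
  | .inr (.inl _), .inl _ => exact absurd h (quadratic_not_equiv_bilinear h2 _ _ _ _ _)
  | .inr (.inl (w, v)), .inr (.inl (w', v')) =>
    obtain ⟨hv, rfl⟩ := quadratic_injective h2 h
    rw [Units.ext (add_left_cancel hv)]
  | .inr (.inl _), .inr (.inr _) =>
    exact absurd (h.map RingEquiv.symm) (central_not_equiv_quadratic h2 (hc _) _ _ _)
  | .inr (.inr _), .inl _ => exact absurd h (central_not_equiv_bilinear h2 (hc _) _ _ _ _)
  | .inr (.inr _), .inr (.inl _) => exact absurd h (central_not_equiv_quadratic h2 (hc _) _ _ _)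
  | .inr (.inr (i, j)), .inr (.inr (i', j')) =>
    obtain ⟨rfl, rfl⟩ := central_injective h2 hν h
    rfl

theorem cubeModel_injective (h2 : (2 : ZMod p) ≠ 0) (i j : CubeIndex p)
    (h : Nonempty ((cubeModel i).Carrier ≃+* (cubeModel j).Carrier)) : i = j := by
  match i, j with
  | .inl s, .inl s' => rw [(bilinear_injective h2 h).1]
  | .inl _, .inr _ =>
    exact absurd (h.map RingEquiv.symm) (quadratic_not_equiv_bilinear h2 _ _ _ _ _)
  | .inr _, .inl _ => exact absurd h (quadratic_not_equiv_bilinear h2 _ _ _ _ _)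
  | .inr w, .inr w' => rw [(quadratic_injective h2 h).1]

/-- Every skew brace of Heisenberg type is isomorphic to one of the representatives. -/
theorem exists_model (h2 : (2 : ZMod p) ≠ 0) {ν : ZMod p} (hν : ¬IsSquare ν)
    {B : Type u} [SkewBrace B] (e : B ≃+ Heis p) :
    (∃ i, Nonempty (B ≃+* (heisModel ν i).Carrier)) ∨
      ∃ i : CubeIndex p, Nonempty (B ≃+* (cubeModel i).Carrier) := by
  obtain ⟨D, ⟨φ⟩⟩ := SkewBrace.exists_braceData h2 e
  rcases exists_normal_form h2 hν (fun a => ZMod.isSquare_div_of_not_isSquare hν) D with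
    ⟨s, c, ⟨ψ⟩⟩ | ⟨u, w, ⟨ψ⟩⟩ | ⟨i, j, ⟨ψ⟩⟩
  · by_cases hc : c = 0
    · subst hc
      exact Or.inr ⟨.inl s, ⟨φ.trans ψ⟩⟩
    · exact Or.inl ⟨.inl (s, Units.mk0 c hc), ⟨φ.trans ψ⟩⟩
  · by_cases huw : u = w
    · subst huw
      exact Or.inr ⟨.inr u, ⟨φ.trans ψ⟩⟩
    · obtain ⟨v, rfl⟩ : ∃ v, u = w + v := ⟨u - w, by ring⟩
      exact Or.inl ⟨.inr (.inl (w, Units.mk0 v fun h => huw (by rw [h, add_zero]))),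
        ⟨φ.trans ψ⟩⟩
  · exact Or.inl ⟨.inr (.inr (i, j)), ⟨φ.trans ψ⟩⟩

end BraceData

end Classification

theorem theorem2 (p : ℕ) (hp : p.Prime) (hp3 : 3 < p) :
    Nat.card (SkewBraceClasses.{u} (HeisenbergGroup p) (HeisenbergGroup p))
        = 2 * p ^ 2 - p + 3 ∧
      Nat.card (SkewBraceClasses.{u} (HeisenbergGroup p) (ElementaryAbelianCube p))
        = 2 * p + 1 ∧
      ∀ (B : Type u) [SkewBrace B], Nonempty (B ≃+ Additive (HeisenbergGroup p)) →
        Nonempty (B ≃* HeisenbergGroup p) ∨ Nonempty (B ≃* ElementaryAbelianCube p) := by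
  have : Fact p.Prime := ⟨hp⟩
  have h2 := ZMod.two_ne_zero_of_three_lt hp3
  obtain ⟨e⟩ := nonempty_heisenbergGroup_mulEquiv hp3
  obtain ⟨ν, hν⟩ := FiniteField.exists_nonsquare (F := ZMod p) (by
    rw [ZMod.ringChar_zmod_n]; omega)
  have hν0 : ν ≠ 0 := by rintro rfl; exact hν IsSquare.zero
  have hne := Heis.isEmpty_mulEquiv_cube h2
  have hheis := BraceData.heisModel_mulEquiv hp3 hν0
  have hcube := BraceData.cubeModel_mulEquiv hp3
  refine ⟨?_, ?_, ?_⟩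
  · rw [SkewBraceClasses.nat_card_eq e (BraceData.heisModel ν) (fun i => (hheis i).map (·.trans e.symm))
      (BraceData.heisModel_injective h2 hν) ?_, BraceData.nat_card_heisIndex]
    rintro B _ ⟨f⟩ ⟨g⟩
    -- A model from the other list would identify the nonabelian Heisenberg group with the
    -- elementary abelian one.
    refine (BraceData.exists_model h2 hν f).resolve_right ?_
    rintro ⟨i, ⟨φ⟩⟩
    obtain ⟨ψ⟩ := hcube i
    exact hne.false (((e.symm.trans g.symm).trans φ.toMulEquiv).trans ψ)
  · rw [SkewBraceClasses.nat_card_eq e BraceData.cubeModel hcube (BraceData.cubeModel_injective h2) ?_,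
      BraceData.nat_card_cubeIndex]
    rintro B _ ⟨f⟩ ⟨g⟩
    refine (BraceData.exists_model h2 hν f).resolve_left ?_
    rintro ⟨i, ⟨φ⟩⟩
    obtain ⟨ψ⟩ := hheis i
    exact hne.false ((ψ.symm.trans φ.symm.toMulEquiv).trans g)
  · rintro B _ ⟨f⟩
    have f' : B ≃+ Heis p :=
      (f.trans (MulEquiv.toAdditive e)).trans (AddEquiv.additiveMultiplicative _)
    rcases BraceData.exists_model h2 hν f' with ⟨i, ⟨φ⟩⟩ | ⟨i, ⟨φ⟩⟩
    · exact Or.inl ((hheis i).map fun ψ => (φ.toMulEquiv.trans ψ).trans e.symm)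
    · exact Or.inr ((hcube i).map φ.toMulEquiv.trans)
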